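/- **Null asymptotics of the PCA-based gradual-change statistic.** Let $\mathcal H=L^2(\mathcal Z,\nu)$ with $\nu$ $\sigma$-finite and $\mathcal H$ separable, and write $(v\otimes w)(x)=\langle v,x\rangle w$. Let $\{\varepsilon_i\}_{i\in\mathbb Z}$ be a centered, strictly stationary sequence of $\mathcal H$-valued random variables such that: * $\mathsf E\|\varepsilon_1\|^{k}<\infty$ for some $k>2$; with $C_r=\mathsf E[\varepsilon_0\otimes\varepsilon_r]$ one has $\sum_{r\in\mathbb Z}\|C_r\|<\infty$ (operator norm) and $C_\varepsilon:=\sum_{r\in\mathbb Z}C_r\neq 0$; * $C_\varepsilon=\sum_{p\ge 1}\lambda_p\,v_p\otimes v_p$ with $\lambda_1\ge\lambda_2\ge\cdots$ and $\{v_p\}_{p\in\mathbb N}$ orthonormal, and $\sum_{p\ge 1}\sum_{r\in\mathbb Z}|\mathsf{Cov}(\langle\varepsilon_0,v_p\rangle,\langle\varepsilon_r,v_p\rangle)|<\infty$; * $\big\{n^{-1/2}\sum_{i=1}^{\lfloor tn\rfloor}\varepsilon_i\big\}_{t\in[0,1]}$ converges weakly, in the Skorokhod space $D^{\mathcal H}[0,1]$,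 to an $\mathcal H$-valued Brownian motion with covariance operator $C_\varepsilon$. Let $h:[-1,1]\to\mathbb R$ be non-constant, of bounded total variation, with $h(x)=0$ for $x\le 0$ and Hölder continuous of some order $\alpha>0$ on $[0,1]$. For each $n$, let the observations be $X_i=\mu_i+\varepsilon_i$, $i=1,\dots,n$, with deterministic $\mu_i\in\mathcal H$. Let $\hat C=\hat C_n$ be random bounded operators on $\mathcal H$ with $\|\hat C_n-C_\varepsilon\|=o_P(1)$, and for a fixed $d$ let $\hat\lambda_1\ge\dots\ge\hat\lambda_d$ be the $d$ largest eigenvalues of $\hat C_n$, counted with multiplicity, with corresponding orthonormal eigenfunctions $\hat v_1,\dots,\hat v_d$, all of them random variables. With $\hat\eta_{i,p}=\langle X_i,\hat v_p\rangle$ and $\bar{\hat\eta}_{n,p}=\frac1n\sum_{i=1}^n\hat\eta_{i,p}$ let $$T_{n,\mathrm{PC}}(h;\hat C)=\left(\max_{1\le k<n}\sum_{p=1}^d\frac1{\hat\lambda_p}\,\frac1n\left[\sum_{i=1}^n h\!\left(\frac{i-k}n\right)\big(\hat\eta_{i,p}-\bar{\hat\eta}_{n,p}\big)\right]^2\right)^{1/2}.$$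 Assume $\lambda_1>\dots>\lambda_d>0$ and, for $p=1,\dots,d$, $$\|\hat v_p-s_p v_p\|=o_P(1),\qquad \hat\lambda_p-\lambda_p=o_P(1),\qquad s_p=\operatorname{sgn}\langle\hat v_p,v_p\rangle .$$ Then, under $H_0:\mu_1=\dots=\mu_n$, as $n\to\infty$, $$T_{n,\mathrm{PC}}(h;\hat C)\ \overset{\mathcal D}{\longrightarrow}\ \sup_{0\le t\le 1}\sqrt{\sum_{p=1}^d G_p^2(t)},\qquad G_p(t)=\int_0^{1-t}B_p(1-t-y)\,dh(y),$$ where $B_1,\dots,B_d$ are independent standard Brownian bridges on $[0,1]$. -/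

import Mathlib

open MeasureTheory ProbabilityTheory Filter Topology Set unitInterval
open scoped ENNReal NNReal RealInnerProductSpace

noncomputable section

/-! ### The space of càdlàg paths on the unit interval, with the Skorokhod `J₁` distance -/

/-- Càdlàg functions from `[0,1]` to `E`: right-continuous at every point, with a left limit at
every point. -/
structure CadlagPath (E : Type*) [TopologicalSpace E] where
  toFun : I → E
  right_continuous : ∀ t, ContinuousWithinAt toFun (Ici t) t
  left_limit : ∀ t, ∃ l, Tendsto toFun (𝓝[<] t) (𝓝 l)

namespace CadlagPath

instance {E : Type*} [TopologicalSpace E] : CoeFun (CadlagPath E) (fun _ => I → E) :=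
  ⟨CadlagPath.toFun⟩

/-- The cost of a time change `φ`, an increasing bijection of `[0,1]`, for matching `f` with `g`. -/
def skorokhodCost {E : Type*} [PseudoEMetricSpace E] (f g : CadlagPath E) (φ : I ≃o I) : ℝ≥0∞ :=
  (⨆ t, edist (φ t) t) ⊔ (⨆ t, edist (f t) (g (φ t)))

/-- The Skorokhod `J₁` distance: the infimum of the costs of all the time changes. -/
instance {E : Type*} [PseudoEMetricSpace E] : EDist (CadlagPath E) :=
  ⟨fun f g => ⨅ φ : I ≃o I, skorokhodCost f g φ⟩

theorem edist_def {E : Type*} [PseudoEMetricSpace E] (f g : CadlagPath E) :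
    edist f g = ⨅ φ : I ≃o I, skorokhodCost f g φ := rfl

theorem skorokhodCost_refl {E : Type*} [PseudoEMetricSpace E] (f : CadlagPath E) :
    skorokhodCost f f (OrderIso.refl I) = 0 := by
  simp [skorokhodCost]

theorem skorokhodCost_symm {E : Type*} [PseudoEMetricSpace E] (f g : CadlagPath E) (φ : I ≃o I) :
    skorokhodCost g f φ.symm ≤ skorokhodCost f g φ := by
  refine sup_le_sup (iSup_le fun t => ?_) (iSup_le fun t => ?_)
  · refine le_trans (le_of_eq ?_) (le_iSup (fun s => edist (φ s) s) (φ.symm t))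
    simp [edist_comm]
  · refine le_trans (le_of_eq ?_) (le_iSup (fun s => edist (f s) (g (φ s))) (φ.symm t))
    simp [edist_comm]

theorem skorokhodCost_trans {E : Type*} [PseudoEMetricSpace E] (f g k : CadlagPath E)
    (φ ψ : I ≃o I) :
    skorokhodCost f k (φ.trans ψ) ≤ skorokhodCost f g φ + skorokhodCost g k ψ := by
  refine sup_le (iSup_le fun t => ?_) (iSup_le fun t => ?_)
  · refine (edist_triangle _ (φ t) _).trans ?_
    rw [add_comm]
    exact add_le_add ((le_iSup (fun s => edist (φ s) s) t).trans le_sup_left)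
      ((le_iSup (fun s => edist (ψ s) s) (φ t)).trans le_sup_left)
  · refine (edist_triangle _ (g (φ t)) _).trans ?_
    exact add_le_add ((le_iSup (fun s => edist (f s) (g (φ s))) t).trans le_sup_right)
      ((le_iSup (fun s => edist (g s) (k (ψ s))) (φ t)).trans le_sup_right)

instance {E : Type*} [PseudoEMetricSpace E] : PseudoEMetricSpace (CadlagPath E) where
  edist_self f := le_antisymm
    ((iInf_le _ (OrderIso.refl I)).trans (skorokhodCost_refl f).le) bot_le
  edist_comm f g := le_antisymm
    (le_iInf fun φ => (iInf_le _ φ.symm).trans (skorokhodCost_symm g f φ))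
    (le_iInf fun φ => (iInf_le _ φ.symm).trans (skorokhodCost_symm f g φ))
  edist_triangle f g k := by
    simp only [edist_def]
    exact ENNReal.le_iInf_add_iInf fun φ ψ =>
      (iInf_le _ (φ.trans ψ)).trans (skorokhodCost_trans f g k φ ψ)

/-- The Borel σ-algebra of the Skorokhod topology. -/
instance {E : Type*} [PseudoEMetricSpace E] : MeasurableSpace (CadlagPath E) := borel _

instance {E : Type*} [PseudoEMetricSpace E] : BorelSpace (CadlagPath E) := ⟨rfl⟩

end CadlagPath

/-! ### Stationarity, long-run covariance, partial sums, Brownian motion -/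

section Hilbert

variable {H : Type*} [NormedAddCommGroup H] [InnerProductSpace ℝ H]

/-- Strict stationarity: the law of the whole sequence is invariant under all time shifts. -/
def StrictlyStationary {Ω : Type*} [MeasurableSpace Ω] [MeasurableSpace H]
    (ε : ℤ → Ω → H) (P : Measure Ω) : Prop :=
  ∀ k : ℤ, IdentDistrib (fun ω i => ε (i + k) ω) (fun ω i => ε i ω) P P

/-- The lag-`r` covariance operator `C_r = E[ε₀ ⊗ ε_r]`, where `(v ⊗ w) x = ⟪v, x⟫ w`. -/
def lagCovOp {Ω : Type*} [MeasurableSpace Ω] (ε : ℤ → Ω → H) (P : Measure Ω) (r : ℤ) : H →L[ℝ] H :=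
  ∫ ω, InnerProductSpace.rankOne ℝ (ε r ω) (ε 0 ω) ∂P

/-- The long-run covariance operator `∑_{r ∈ ℤ} C_r`. -/
def longRunCovOp {Ω : Type*} [MeasurableSpace Ω] (ε : ℤ → Ω → H) (P : Measure Ω) : H →L[ℝ] H :=
  ∑' r : ℤ, lagCovOp ε P r

theorem tendsto_natFloor_mul_right (n : ℕ) (t : I) :
    ∀ᶠ s : I in 𝓝[≥] t, ⌊(s : ℝ) * n⌋₊ = ⌊(t : ℝ) * n⌋₊ := by
  have h1 : Tendsto (fun s : I => (s : ℝ) * n) (𝓝[≥] t) (𝓝[≥] ((t : ℝ) * n)) := by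
    refine tendsto_nhdsWithin_of_tendsto_nhds_of_eventually_within _ ?_ ?_
    · exact (Continuous.tendsto (by fun_prop) t).mono_left nhdsWithin_le_nhds
    · filter_upwards [self_mem_nhdsWithin] with s hs
      exact mul_le_mul_of_nonneg_right (show (t : ℝ) ≤ s from hs) n.cast_nonneg
  have h2 := (tendsto_floor_right_pure_floor ((t : ℝ) * n)).comp h1
  filter_upwards [tendsto_pure.1 h2] with s hs
  have hs' : ⌊(s : ℝ) * n⌋ = ⌊(t : ℝ) * n⌋ := hs
  rw [← Int.floor_toNat, ← Int.floor_toNat, hs']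

theorem tendsto_natFloor_mul_left (n : ℕ) (t : I) :
    ∃ m : ℕ, ∀ᶠ s : I in 𝓝[<] t, ⌊(s : ℝ) * n⌋₊ = m := by
  rcases Nat.eq_zero_or_pos n with rfl | hn
  · exact ⟨0, by simp⟩
  have h1 : Tendsto (fun s : I => (s : ℝ) * n) (𝓝[<] t) (𝓝[<] ((t : ℝ) * n)) := by
    refine tendsto_nhdsWithin_of_tendsto_nhds_of_eventually_within _ ?_ ?_
    · exact (Continuous.tendsto (by fun_prop) t).mono_left nhdsWithin_le_nhds
    · filter_upwards [self_mem_nhdsWithin] with s hs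
      exact mul_lt_mul_of_pos_right (show (s : ℝ) < t from hs) (by exact_mod_cast hn)
  have h2 := (tendsto_floor_left_pure_ceil_sub_one ((t : ℝ) * n)).comp h1
  refine ⟨(⌈(t : ℝ) * n⌉ - 1).toNat, ?_⟩
  filter_upwards [tendsto_pure.1 h2] with s hs
  have hs' : ⌊(s : ℝ) * n⌋ = ⌈(t : ℝ) * n⌉ - 1 := hs
  rw [← Int.floor_toNat, hs']

/-- The normalized partial-sum path `t ↦ n^{-1/2} ∑_{i=1}^{⌊tn⌋} e_i`, as an element of the
Skorokhod space. -/
def partialSumPath (e : ℤ → H) (n : ℕ) : CadlagPath H where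
  toFun t := (√(n : ℝ))⁻¹ • ∑ i ∈ Finset.Icc 1 ⌊(t : ℝ) * n⌋₊, e (i : ℤ)
  right_continuous t := by
    refine tendsto_nhds_of_eventually_eq ?_
    filter_upwards [tendsto_natFloor_mul_right n t] with s hs
    rw [hs]
  left_limit t := by
    obtain ⟨m, hm⟩ := tendsto_natFloor_mul_left n t
    refine ⟨(√(n : ℝ))⁻¹ • ∑ i ∈ Finset.Icc 1 m, e (i : ℤ), tendsto_nhds_of_eventually_eq ?_⟩
    filter_upwards [hm] with s hs
    rw [hs]

/-- `W` is an `H`-valued Brownian motion on `[0,1]` with covariance operator `C` (a positive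
operator): it starts at `0`, has independent increments, `W t - W s` is centred Gaussian with
covariance operator `(t - s) C`, and almost every path is continuous. -/
structure IsHilbertBrownianMotion {Ω : Type*} [MeasurableSpace Ω] [MeasurableSpace H]
    (C : H →L[ℝ] H) (W : I → Ω → H) (P : Measure Ω) : Prop where
  zero : ∀ᵐ ω ∂P, W 0 ω = 0
  indep : HasIndepIncrements W P
  gaussian : ∀ s t : I, s ≤ t → ∀ x : H, HasLaw (fun ω => ⟪W t ω - W s ω, x⟫)
    (gaussianReal 0 (((t : ℝ) - s) * ⟪C x, x⟫).toNNReal) P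
  cont : ∀ᵐ ω ∂P, Continuous fun t => W t ω

/-- `lam 0 ≥ lam 1 ≥ …` are the `d` largest eigenvalues of `A`, counted with multiplicity, and the
`v p` are corresponding orthonormal eigenvectors: every eigenvalue of `A` that has an eigenvector
orthogonal to all the `v p` is at most every `lam p`. -/
structure IsLeadingEigensystem {d : ℕ} (A : H →L[ℝ] H) (lam : Fin d → ℝ) (v : Fin d → H) :
    Prop where
  orthonormal : Orthonormal ℝ v
  eigen : ∀ p, A (v p) = lam p • v p
  antitone : Antitone lam
  largest : ∀ (κ : ℝ) (x : H), x ≠ 0 → A x = κ • x → (∀ p, ⟪v p, x⟫ = 0) → ∀ p, κ ≤ lam p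

/-- The squared PCA-based statistic for gradual changes,
`max_{1 ≤ k < n} ∑_p λ̂_p⁻¹ n⁻¹ (∑_{i=1}^n h((i-k)/n) (η̂_{i,p} - mean of η̂_{·,p}))²`
with the scores `η̂_{i,p} = ⟪X_i, v̂_p⟫`. -/
def gradualPCStatSq {d : ℕ} (h : ℝ → ℝ) (n : ℕ) (X : ℕ → H) (lam : Fin d → ℝ) (v : Fin d → H) :
    ℝ :=
  ⨆ k : Finset.Ico 1 n, ∑ p : Fin d, 1 / lam p * (1 / (n : ℝ)) *
    (∑ i ∈ Finset.Icc 1 n, h (((i : ℝ) - (k : ℕ)) / n) *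
      (⟪X i, v p⟫ - (1 / (n : ℝ)) * ∑ j ∈ Finset.Icc 1 n, ⟪X j, v p⟫)) ^ 2

/-- The PCA-based statistic for gradual changes. -/
def gradualPCStat {d : ℕ} (h : ℝ → ℝ) (n : ℕ) (X : ℕ → H) (lam : Fin d → ℝ) (v : Fin d → H) : ℝ :=
  √(gradualPCStatSq h n X lam v)

end Hilbert

/-! ### The weight function, Brownian bridges, and the limit process -/

/-- The class of weight functions. Only the values of `h` on `[-1,1]` matter. -/
structure IsGradualWeight (h : ℝ → ℝ) : Prop where
  nonconstant : ∃ x ∈ Icc (-1 : ℝ) 1, ∃ y ∈ Icc (-1 : ℝ) 1, h x ≠ h y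
  eq_zero : ∀ x ∈ Icc (-1 : ℝ) 0, h x = 0
  boundedVariation : BoundedVariationOn h (Icc (-1) 1)
  holder : ∃ α > (0 : ℝ), ∃ β > (0 : ℝ), ∀ s ∈ Icc (0 : ℝ) 1, ∀ t ∈ Icc (0 : ℝ) 1,
    |h t - h s| ≤ β * |s - t| ^ α

/-- The restriction of `h` to `[-1,1]`, extended to the real line by constants. -/
def clampWeight (h : ℝ → ℝ) (x : ℝ) : ℝ :=
  h (projIcc (-1 : ℝ) 1 (by norm_num) x)

theorem IsGradualWeight.boundedVariation_clamp {h : ℝ → ℝ} (hh : IsGradualWeight h) :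
    BoundedVariationOn (clampWeight h) univ := by
  have hm : MonotoneOn (fun x : ℝ => ((projIcc (-1 : ℝ) 1 (by norm_num) x : Icc (-1 : ℝ) 1) : ℝ))
      univ := fun x _ y _ hxy => monotone_projIcc _ hxy
  have hle := eVariationOn.comp_le_of_monotoneOn h (s := Icc (-1 : ℝ) 1) (t := univ) _ hm
    (fun x _ => Subtype.coe_prop _)
  exact ne_top_of_le_ne_top hh.boundedVariation hle

/-- The signed Lebesgue–Stieltjes measure `dh`. -/
def IsGradualWeight.stieltjes {h : ℝ → ℝ} (hh : IsGradualWeight h) : SignedMeasure ℝ :=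
  hh.boundedVariation_clamp.vectorMeasure

/-- A standard Brownian bridge on `[0,1]`: a centred Gaussian process with covariance
`min s t - s t` and almost surely continuous paths. -/
structure IsBrownianBridge {Ω : Type*} [MeasurableSpace Ω] (B : I → Ω → ℝ) (P : Measure Ω) :
    Prop where
  gaussian : IsGaussianProcess B P
  mean : ∀ t, ∫ ω, B t ω ∂P = 0
  cov : ∀ s t : I, cov[B s, B t; P] = min (s : ℝ) t - s * t
  cont : ∀ᵐ ω ∂P, Continuous fun t => B t ω

/-- The pathwise functional `G(t) = ∫_0^{1-t} b(1-t-y) dh(y)`; for `0 < y ≤ 1 - t` the argument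
`1 - t - y` lies in `[0,1]`, so that the projection to `[0,1]` does nothing. -/
def gradualLimitPath {h : ℝ → ℝ} (hh : IsGradualWeight h) (b : I → ℝ) (t : I) : ℝ :=
  VectorMeasure.integral (hh.stieltjes.restrict (Ioc 0 (1 - (t : ℝ))))
    (fun y : ℝ => b (projIcc 0 1 zero_le_one (1 - (t : ℝ) - y))) (ContinuousLinearMap.lsmul ℝ ℝ)

end

/-!
Write `S` for the partial-sum path and `S°(s) = S(s) - s S(1)` for its bridge. Under a constant mean
the scores can be centred without changing the statistic, and a summation by parts, in which `h(0) = 0`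
and `S°(1) = 0` remove the boundary terms, turns the weighted score sums into Riemann–Stieltjes sums of
`S°` against `dh` (`sum_weight_mul_centred`). Since the scores enter through squares, the random signs of
the estimated eigenvectors do not matter, and the factors `1 / λ̂_p` can be absorbed into the directions:
the statistic is `gridStatSq` of the scalar bridges of `S` in the directions `s_p v̂_p / √λ̂_p`
(`gradualPCStat_eq`).

If bridges `r_n` converge uniformly to a continuous `r` with `r(1) = 0`, these discrete functionals
converge to the limit functional of the time reversal of `r` (`tendsto_sqrt_gridStatSq`). Indeed,
extending `r` by `0` beyond `1` makes the limit path an integral of a translate of `r` over the fixed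
interval `(0,1]`, so that everything is controlled by the modulus of continuity of `r` times the total
variation of `dh`; the continuity of `h` on `[0,1]` identifies the mass of `(a,b]` with `h(b) - h(a)`.

Skorokhod convergence to a continuous path is uniform, so the functionals converge jointly in the path
and in the directions at almost every path of the Brownian motion. An extended continuous mapping
theorem (`tendstoInDistribution_of_tendsto_nhds_ae`) then gives convergence in distribution to the
limit functional of the Brownian motion; it treats the estimated directions together with the path, so
that no tightness argument is needed.

Finally, in the directions `v_p / √λ_p` the bridges of the Brownian motion are independent Brownian
bridges: they form a Gaussian process, because increments are independent and Gaussian, and their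
covariances follow by polarization. Time reversal preserves Brownian bridges. The law of the limit
functional is the same for all families of independent Brownian bridges (`map_limitStat_eq`), because
it is an almost sure limit of functionals of finitely many coordinates.
-/

/-! ### The Stieltjes measure of the weight function -/

namespace MeasureTheory.SignedMeasure

instance isFiniteMeasure_variation {X : Type*} [MeasurableSpace X] (μ : SignedMeasure X) :
    IsFiniteMeasure (VectorMeasure.variation μ) := by
  rw [← totalVariation_eq_variation]
  infer_instance

/-- A bounded measurable function is integrable with respect to a restricted signed measure. -/
theorem integrable_restrict_of_bounded {X : Type*} [MeasurableSpace X] (μ : SignedMeasure X)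
    (s : Set X) {f : X → ℝ} (hf : Measurable f) {C : ℝ} (hC : ∀ x, |f x| ≤ C) :
    VectorMeasure.Integrable (μ.restrict s) f :=
  haveI := isFiniteMeasure_variation (μ.restrict s)
  MeasureTheory.Integrable.of_bound hf.aestronglyMeasurable C (ae_of_all _ hC)

/-- The integral over `s` of two bounded functions that differ by at most `η` on `s` differ by at
most `η |μ|(s)`. -/
theorem abs_setIntegral_sub_le {X : Type*} [MeasurableSpace X] (μ : SignedMeasure X)
    (s : Set X) {f g : X → ℝ} (hf : Measurable f) (hg : Measurable g) {C D η : ℝ}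
    (hC : ∀ x, |f x| ≤ C) (hD : ∀ x, |g x| ≤ D) (h : ∀ x ∈ s, |f x - g x| ≤ η) :
    |VectorMeasure.integral (μ.restrict s) f (ContinuousLinearMap.lsmul ℝ ℝ) -
      VectorMeasure.integral (μ.restrict s) g (ContinuousLinearMap.lsmul ℝ ℝ)| ≤
        η * (VectorMeasure.variation μ).real s := by
  rw [← VectorMeasure.integral_sub (μ.integrable_restrict_of_bounded s hf hC)
    (μ.integrable_restrict_of_bounded s hg hD)]
  have := VectorMeasure.norm_setIntegral_le_of_norm_le_const (μ := μ) (s := s)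
    (f := f - g) (B := ContinuousLinearMap.lsmul ℝ ℝ) h
  simpa using this

end MeasureTheory.SignedMeasure

namespace IsGradualWeight

variable {h : ℝ → ℝ}

theorem continuousOn_clampWeight (hh : IsGradualWeight h) : ContinuousOn (clampWeight h) (Ici 0) := by
  have h1 : ContinuousOn h (Icc 0 1) := by
    obtain ⟨α, hα, β, hβ, H⟩ := hh.holder
    intro s hs
    rw [ContinuousWithinAt, tendsto_iff_dist_tendsto_zero]
    have h2 : Tendsto (fun t : ℝ => β * |s - t| ^ α) (𝓝[Icc 0 1] s) (𝓝 0) := by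
      have : Continuous fun t : ℝ => β * |s - t| ^ α := by
        have : Continuous fun t : ℝ => |s - t| := by fun_prop
        exact continuous_const.mul (this.rpow_const fun _ => Or.inr hα.le)
      have h3 := (this.tendsto s).mono_left (nhdsWithin_le_nhds (s := Icc 0 1))
      simpa [Real.zero_rpow hα.ne'] using h3
    refine squeeze_zero' (Eventually.of_forall fun _ => dist_nonneg) ?_ h2
    filter_upwards [self_mem_nhdsWithin] with t ht
    exact H s hs t ht
  refine h1.comp (t := Icc 0 1) (by fun_prop) fun x hx => ?_
  have hx : (0 : ℝ) ≤ x := hx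
  rw [coe_projIcc]
  exact ⟨by simp [hx], by simp⟩

theorem clampWeight_eq {x : ℝ} (hx : x ∈ Icc (-1 : ℝ) 1) : clampWeight h x = h x := by
  simp [clampWeight, projIcc_of_mem _ hx]

theorem stieltjes_Ioc (hh : IsGradualWeight h) {a b : ℝ} (ha : 0 ≤ a) (hab : a ≤ b) (hb : b ≤ 1) :
    hh.stieltjes (Ioc a b) = h b - h a := by
  have hr : ∀ x, 0 ≤ x → x ≤ 1 → Function.rightLim (clampWeight h) x = h x := fun x hx hx1 => by
    rw [ContinuousWithinAt.rightLim_eq, clampWeight_eq ⟨by linarith, hx1⟩]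
    exact (hh.continuousOn_clampWeight x hx).mono (Ici_subset_Ici.2 hx)
  rw [stieltjes, BoundedVariationOn.vectorMeasure_Ioc _ hab, hr a ha (hab.trans hb),
    hr b (ha.trans hab) hb]

end IsGradualWeight

/-! ### Discretization of the limit functional -/

/-- The Riemann–Stieltjes sum `∑_{j < n} r((k + j)/n) (h((j + 1)/n) - h(j/n))`, where `r` is
extended to the real line by constants. -/
noncomputable def stieltjesSum (h : ℝ → ℝ) (n k : ℕ) (r : I → ℝ) : ℝ :=
  ∑ j ∈ Finset.range n, r (projIcc 0 1 zero_le_one (((k : ℝ) + j) / n)) *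
    (h (((j : ℝ) + 1) / n) - h ((j : ℝ) / n))

/-- The discrete functional `max_{1 ≤ k < n} ‖(stieltjesSum h n k (r p))_p‖²` of which the squared
test statistic is a value. -/
noncomputable def gridStatSq {d : ℕ} (h : ℝ → ℝ) (n : ℕ) (r : Fin d → I → ℝ) : ℝ :=
  ⨆ k : Finset.Ico 1 n, ∑ p : Fin d, stieltjesSum h n k (r p) ^ 2

/-- The limit functional `b ↦ sup_t (∑_p (∫_0^{1-t} b_p(1-t-y) dh(y))²)^{1/2}`. -/
noncomputable def limitStat {d : ℕ} {h : ℝ → ℝ} (hh : IsGradualWeight h) (b : Fin d → I → ℝ) : ℝ :=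
  ⨆ t : I, √(∑ p : Fin d, gradualLimitPath hh (b p) t ^ 2)

section Analysis

variable {h : ℝ → ℝ}

/-- After time reversal the limit path is the integral of a translate of `r` over the fixed
interval `(0,1]`: the condition `r 1 = 0` makes the part beyond `1 - t` vanish. -/
theorem gradualLimitPath_comp_symm (hh : IsGradualWeight h) {r : I → ℝ} (hr1 : r 1 = 0) (t : I) :
    gradualLimitPath hh (r ∘ σ) t = VectorMeasure.integral (hh.stieltjes.restrict (Ioc 0 1))
      (fun y : ℝ => r (projIcc 0 1 zero_le_one (t + y))) (ContinuousLinearMap.lsmul ℝ ℝ) := by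
  have h0 : (0 : ℝ) ≤ t := t.2.1
  have hproj : ∀ y : ℝ, 1 - (t : ℝ) < y → r (projIcc 0 1 zero_le_one (t + y)) = 0 := fun y hy => by
    rw [projIcc_of_right_le _ (by linarith)]
    exact hr1
  rw [gradualLimitPath, VectorMeasure.setIntegral_eq_of_subset_of_forall_sdiff_eq_zero
    measurableSet_Ioc measurableSet_Ioc (Ioc_subset_Ioc_right (by linarith : 1 - (t : ℝ) ≤ 1))]
  · rw [← VectorMeasure.integral_indicator measurableSet_Ioc,
      ← VectorMeasure.integral_indicator measurableSet_Ioc]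
    congr 1
    ext y
    by_cases hy : y ∈ Ioc (0 : ℝ) (1 - t)
    · rw [indicator_of_mem hy, indicator_of_mem hy, Function.comp_apply]
      have h1 : (t : ℝ) + y ≤ 1 := by linarith [hy.2]
      congr 1
      ext
      simp only [coe_symm_eq, coe_projIcc]
      rw [min_eq_right (by linarith [hy.1] : 1 - (t : ℝ) - y ≤ 1), min_eq_right h1,
        max_eq_right (by linarith), max_eq_right (by linarith [hy.1])]
      ring
    · rw [indicator_of_notMem hy, indicator_of_notMem hy]
  · exact fun y hy => hproj y (not_le.1 fun hc => hy.2 ⟨hy.1.1, hc⟩)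

theorem exists_abs_le_of_continuous {r : I → ℝ} (hr : Continuous r) : ∃ C, ∀ s, |r s| ≤ C := by
  obtain ⟨C, hC⟩ := isCompact_univ.exists_bound_of_continuousOn hr.continuousOn
  exact ⟨C, fun s => hC s (mem_univ s)⟩

/-- The limit path inherits the modulus of continuity of `r`, up to the total variation of `dh`. -/
theorem abs_gradualLimitPath_sub_le (hh : IsGradualWeight h) {r : I → ℝ} (hr : Continuous r)
    (hr1 : r 1 = 0) {η δ : ℝ} (hη : ∀ s s' : I, |(s : ℝ) - s'| ≤ δ → |r s - r s'| ≤ η) {t t' : I}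
    (htt : |(t : ℝ) - t'| ≤ δ) :
    |gradualLimitPath hh (r ∘ σ) t - gradualLimitPath hh (r ∘ σ) t'| ≤
      η * (VectorMeasure.variation hh.stieltjes).real (Ioc 0 1) := by
  obtain ⟨C, hC⟩ := exists_abs_le_of_continuous hr
  rw [gradualLimitPath_comp_symm hh hr1, gradualLimitPath_comp_symm hh hr1]
  refine SignedMeasure.abs_setIntegral_sub_le _ _ (C := C) (D := C) (by fun_prop) (by fun_prop)
    (fun _ => hC _) (fun _ => hC _) fun y _ => hη _ _ ?_
  refine (abs_projIcc_sub_projIcc _).trans ?_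
  simpa using htt

/-- The Riemann–Stieltjes sum of a perturbation `r'` of `r` approximates the limit path at `k / n`: on
each interval `(j/n, (j+1)/n]` the integrand is replaced by a constant. -/
theorem abs_gradualLimitPath_sub_stieltjesSum_le (hh : IsGradualWeight h) {r r' : I → ℝ}
    (hr : Continuous r) (hr1 : r 1 = 0) {η δ : ℝ}
    (hη : ∀ s s' : I, |(s : ℝ) - s'| ≤ δ → |r s - r' s'| ≤ η) {n k : ℕ} (hn : 0 < n)
    (hδ : 1 / (n : ℝ) ≤ δ) {t : I} (ht : (t : ℝ) = k / n) :
    |gradualLimitPath hh (r ∘ σ) t - stieltjesSum h n k r'| ≤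
      η * (VectorMeasure.variation hh.stieltjes).real (Ioc 0 1) := by
  obtain ⟨C, hC⟩ := exists_abs_le_of_continuous hr
  rw [gradualLimitPath_comp_symm hh hr1]
  set f : ℝ → ℝ := fun y => r (projIcc 0 1 zero_le_one (t + y)) with hf
  set c : ℕ → ℝ := fun j => r' (projIcc 0 1 zero_le_one (((k : ℝ) + j) / n)) with hc
  have hfm : Measurable f := by fun_prop
  have hn' : (0 : ℝ) < n := by exact_mod_cast hn
  -- the estimate for the integral over `(0, m/n]`, by induction on `m`
  have key : ∀ m : ℕ, m ≤ n →
      |VectorMeasure.integral (hh.stieltjes.restrict (Ioc 0 ((m : ℝ) / n))) f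
          (ContinuousLinearMap.lsmul ℝ ℝ) - ∑ j ∈ Finset.range m, c j *
            (h (((j : ℝ) + 1) / n) - h ((j : ℝ) / n))| ≤
        η * (VectorMeasure.variation hh.stieltjes).real (Ioc 0 ((m : ℝ) / n)) := by
    intro m
    induction m with
    | zero => simp
    | succ m ih =>
      intro hm
      have h0 : (0 : ℝ) ≤ m / n := by positivity
      have h1 : (m : ℝ) / n ≤ ((m : ℝ) + 1) / n := by gcongr; linarith
      have h2 : ((m : ℝ) + 1) / n ≤ 1 := (div_le_one hn').2 (by exact_mod_cast hm)
      have hdisj : Disjoint (Ioc (0 : ℝ) (m / n)) (Ioc ((m : ℝ) / n) (((m : ℝ) + 1) / n)) :=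
        Ioc_disjoint_Ioc_of_le le_rfl
      push_cast
      rw [← Ioc_union_Ioc_eq_Ioc h0 h1, VectorMeasure.setIntegral_union hdisj measurableSet_Ioc
        measurableSet_Ioc (SignedMeasure.integrable_restrict_of_bounded _ _ hfm fun _ => hC _)
        (SignedMeasure.integrable_restrict_of_bounded _ _ hfm fun _ => hC _),
        measureReal_union hdisj measurableSet_Ioc, Finset.sum_range_succ, mul_add]
      have hlast := SignedMeasure.abs_setIntegral_sub_le hh.stieltjes
        (Ioc ((m : ℝ) / n) (((m : ℝ) + 1) / n)) hfm (measurable_const (a := c m)) (C := C)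
        (D := |c m|) (η := η) (fun _ => hC _) (fun _ => le_rfl) (fun y hy => by
          refine hη _ _ ((abs_projIcc_sub_projIcc _).trans (le_trans ?_ hδ))
          have h3 : (t : ℝ) + y - ((k : ℝ) + m) / n = y - m / n := by rw [ht]; ring
          have h4 : ((m : ℝ) + 1) / n = m / n + 1 / n := by ring
          rw [h3, abs_le]
          constructor <;> linarith [hy.1, hy.2, one_div_pos.2 hn'])
      rw [VectorMeasure.setIntegral_const, hh.stieltjes_Ioc h0 h1 h2,
        ContinuousLinearMap.lsmul_apply, smul_eq_mul] at hlast
      refine le_trans (le_of_eq_of_le ?_ (abs_add_le _ _)) (add_le_add (ih (by omega)) hlast)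
      congr 1
      ring
  have := key n le_rfl
  rwa [div_self hn'.ne'] at this

theorem exists_grid_point {n : ℕ} (hn : 2 ≤ n) (t : I) :
    ∃ k ∈ Finset.Ico 1 n, |(t : ℝ) - k / n| ≤ 1 / n := by
  have hn' : (0 : ℝ) < n := by positivity
  have key : ∀ k : ℕ, (t : ℝ) * n - 1 ≤ k → (k : ℝ) ≤ t * n + 1 → |(t : ℝ) - k / n| ≤ 1 / n := by
    intro k h1 h2
    have h3 : (t : ℝ) - k / n = (t * n - k) / n := by field_simp
    rw [h3, abs_div, abs_of_pos hn']
    gcongr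
    rw [abs_le]
    constructor <;> linarith
  have h0 : 0 ≤ (t : ℝ) * n := mul_nonneg t.2.1 hn'.le
  have h1 : (t : ℝ) * n ≤ n := mul_le_of_le_one_left hn'.le t.2.2
  rcases lt_or_ge ((t : ℝ) * n) 1 with ht | ht
  · exact ⟨1, Finset.mem_Ico.2 ⟨le_rfl, by omega⟩, key 1 (by push_cast; linarith)
      (by push_cast; linarith)⟩
  -- the index `⌈tn⌉ - 1` stays below `n` at `t = 1`; it has to be raised if it is zero
  · have h2 : 1 ≤ ⌈(t : ℝ) * n⌉₊ - 1 ∨ (⌈(t : ℝ) * n⌉₊ - 1 = 0) := by omega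
    have h3 : ⌈(t : ℝ) * n⌉₊ ≤ n := Nat.ceil_le.2 h1
    have h4 : 1 ≤ ⌈(t : ℝ) * n⌉₊ := Nat.one_le_ceil_iff.2 (by linarith)
    have h5 := Nat.le_ceil ((t : ℝ) * n)
    have h6 := Nat.ceil_lt_add_one h0
    rcases h2 with h2 | h2
    · refine ⟨⌈(t : ℝ) * n⌉₊ - 1, Finset.mem_Ico.2 ⟨h2, by omega⟩, key _ ?_ ?_⟩ <;>
      · rw [Nat.cast_sub h4]
        push_cast
        linarith
    · have h7 : ⌈(t : ℝ) * n⌉₊ = 1 := by omega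
      rw [h7] at h5
      push_cast at h5
      exact ⟨1, Finset.mem_Ico.2 ⟨le_rfl, by omega⟩, key 1 (by push_cast; linarith)
        (by push_cast; linarith)⟩

/-- The reverse triangle inequality for the Euclidean norm, in coordinates. -/
theorem sqrt_sum_sq_le_add {d : ℕ} {x y : Fin d → ℝ} {e : ℝ} (he : 0 ≤ e)
    (hxy : ∀ p, |x p - y p| ≤ e) :
    √(∑ p, x p ^ 2) ≤ √(∑ p, y p ^ 2) + √d * e := by
  have h1 := norm_le_norm_add_norm_sub' (WithLp.toLp 2 x : EuclideanSpace ℝ (Fin d))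
    (WithLp.toLp 2 y)
  rw [EuclideanSpace.norm_eq, EuclideanSpace.norm_eq, EuclideanSpace.norm_eq] at h1
  simp only [Real.norm_eq_abs, sq_abs, PiLp.sub_apply] at h1
  refine h1.trans (add_le_add le_rfl ?_)
  rw [← Real.sqrt_sq he, ← Real.sqrt_mul (by positivity)]
  refine Real.sqrt_le_sqrt ?_
  calc ∑ p, (x p - y p) ^ 2 ≤ ∑ _p : Fin d, e ^ 2 :=
        Finset.sum_le_sum fun p _ => by
          rw [← sq_abs]
          exact pow_le_pow_left₀ (abs_nonneg _) (hxy p) 2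
    _ = d * e ^ 2 := by simp

/-- Quantitative form of the convergence of the discrete functional to the limit functional. -/
theorem abs_sqrt_gridStatSq_sub_limitStat_le (hh : IsGradualWeight h) {d : ℕ}
    {r r' : Fin d → I → ℝ} (hr : ∀ p, Continuous (r p)) (hr1 : ∀ p, r p 1 = 0) {η δ : ℝ}
    (hη0 : 0 ≤ η) (hη : ∀ p, ∀ s s' : I, |(s : ℝ) - s'| ≤ δ → |r p s - r p s'| ≤ η)
    (hη' : ∀ p, ∀ s s' : I, |(s : ℝ) - s'| ≤ δ → |r p s - r' p s'| ≤ η) {n : ℕ} (hn : 2 ≤ n)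
    (hδ : 1 / (n : ℝ) ≤ δ) :
    |√(gridStatSq h n r') - limitStat hh (fun p => r p ∘ σ)| ≤
      2 * (√d * (η * (VectorMeasure.variation hh.stieltjes).real (Ioc 0 1))) := by
  set V := (VectorMeasure.variation hh.stieltjes).real (Ioc 0 1) with hV
  have hV0 : 0 ≤ η * V := mul_nonneg hη0 measureReal_nonneg
  have hE0 : 0 ≤ √(d : ℝ) * (η * V) := mul_nonneg (Real.sqrt_nonneg _) hV0
  have hn' : (0 : ℝ) < n := by positivity
  set J : I → ℝ := fun t => √(∑ p : Fin d, gradualLimitPath hh (r p ∘ σ) t ^ 2) with hJ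
  set D : ℕ → ℝ := fun k => ∑ p : Fin d, stieltjesSum h n k (r' p) ^ 2 with hD
  have hD0 : ∀ k, 0 ≤ D k := fun k => Finset.sum_nonneg fun p _ => sq_nonneg _
  have hgrid0 : 0 ≤ gridStatSq h n r' := Real.iSup_nonneg fun k => hD0 k
  have hle : ∀ k ∈ Finset.Ico 1 n, D k ≤ gridStatSq h n r' := fun k hk =>
    le_ciSup (f := fun k : Finset.Ico 1 n => D k) (finite_range _).bddAbove ⟨k, hk⟩
  have hbdd : BddAbove (range J) := by
    refine ⟨J 0 + √d * ∑ p, (2 * (exists_abs_le_of_continuous (hr p)).choose * V), ?_⟩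
    rintro _ ⟨t, rfl⟩
    have h2 : ∀ p, ∀ s s' : I, |r p s - r p s'| ≤
        2 * (exists_abs_le_of_continuous (hr p)).choose := fun p s s' => by
      have := (exists_abs_le_of_continuous (hr p)).choose_spec
      refine (abs_sub _ _).trans ?_
      linarith [this s, this s']
    have h3 : ∀ p, 0 ≤ 2 * (exists_abs_le_of_continuous (hr p)).choose * V := fun p =>
      mul_nonneg ((abs_nonneg _).trans (h2 p 0 0)) measureReal_nonneg
    refine sqrt_sum_sq_le_add (Finset.sum_nonneg fun p _ => h3 p) fun p => ?_
    refine le_trans ?_ (Finset.single_le_sum (fun p _ => h3 p) (Finset.mem_univ p))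
    exact abs_gradualLimitPath_sub_le hh (hr p) (hr1 p) (δ := |(t : ℝ) - (0 : I)|)
      (fun s s' _ => h2 p s s') le_rfl
  have hmem : ∀ k ∈ Finset.Ico 1 n, ∃ t : I, (t : ℝ) = k / n := fun k hk =>
    ⟨⟨k / n, by positivity, (div_le_one hn').2 (by
      exact_mod_cast (Finset.mem_Ico.1 hk).2.le)⟩, rfl⟩
  rw [abs_le]
  constructor
  · have : limitStat hh (fun p => r p ∘ σ) ≤
        √(gridStatSq h n r') + 2 * (√d * (η * V)) := by
      refine ciSup_le fun t => ?_
      obtain ⟨k, hk, hkt⟩ := exists_grid_point hn t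
      obtain ⟨t', ht'⟩ := hmem k hk
      have h1 : J t ≤ J t' + √d * (η * V) := sqrt_sum_sq_le_add hV0 fun p =>
        abs_gradualLimitPath_sub_le hh (hr p) (hr1 p) (hη p) (by rw [ht']; exact hkt.trans hδ)
      have h2 : J t' ≤ √(D k) + √d * (η * V) := sqrt_sum_sq_le_add hV0 fun p =>
        abs_gradualLimitPath_sub_stieltjesSum_le hh (hr p) (hr1 p) (hη' p) (by omega) hδ ht'
      have h3 := Real.sqrt_le_sqrt (hle k hk)
      change J t ≤ _
      linarith
    linarith
  · have hL0 : 0 ≤ limitStat hh (fun p => r p ∘ σ) :=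
      Real.iSup_nonneg fun t => Real.sqrt_nonneg _
    have : √(gridStatSq h n r') ≤ limitStat hh (fun p => r p ∘ σ) + √d * (η * V) := by
      refine Real.sqrt_le_iff.2 ⟨by positivity, ?_⟩
      have : Nonempty (Finset.Ico 1 n) := ⟨⟨1, Finset.mem_Ico.2 ⟨le_rfl, by omega⟩⟩⟩
      refine ciSup_le fun k => ?_
      obtain ⟨t', ht'⟩ := hmem k k.2
      have h2 : √(D k) ≤ J t' + √d * (η * V) := sqrt_sum_sq_le_add hV0 fun p => by
        rw [abs_sub_comm]
        exact abs_gradualLimitPath_sub_stieltjesSum_le hh (hr p) (hr1 p) (hη' p) (by omega) hδ ht'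
      have h3 : J t' ≤ limitStat hh (fun p => r p ∘ σ) := le_ciSup hbdd t'
      exact (Real.sqrt_le_iff.1 (h2.trans (add_le_add_left h3 _))).2
    linarith

/-- The discrete functional converges to the limit functional along uniformly convergent paths. -/
theorem tendsto_sqrt_gridStatSq (hh : IsGradualWeight h) {d : ℕ} {ι : Type*} {l : Filter ι}
    {N : ι → ℕ} (hN : Tendsto N l atTop) {r : Fin d → I → ℝ} {r' : ι → Fin d → I → ℝ}
    (hr : ∀ p, Continuous (r p)) (hr1 : ∀ p, r p 1 = 0)
    (hr' : ∀ p, TendstoUniformly (fun i => r' i p) (r p) l) :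
    Tendsto (fun i => √(gridStatSq h (N i) (r' i))) l (𝓝 (limitStat hh fun p => r p ∘ σ)) := by
  rw [Metric.tendsto_nhds]
  intro ε hε
  set V := (VectorMeasure.variation hh.stieltjes).real (Ioc 0 1) with hV
  have hV0 : 0 ≤ V := measureReal_nonneg
  -- a modulus that makes the bound `2 √d (2η) V` smaller than `ε`, also when `√d V = 0`
  set η := ε / (2 * (√d * V) + 1) / 2 with hηdef
  have hη : 0 < η := by positivity
  have hsmall : 2 * (√d * (2 * η * V)) < ε := by
    have : 2 * (√d * (2 * η * V)) = ε * ((2 * (√d * V)) / (2 * (√d * V) + 1)) := by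
      rw [hηdef]; field_simp
    rw [this]
    exact mul_lt_of_lt_one_right hε ((div_lt_one (by positivity)).2 (lt_add_one _))
  have hmod : ∃ δ > 0, ∀ p, ∀ s s' : I, |(s : ℝ) - s'| ≤ δ → |r p s - r p s'| ≤ η := by
    have h1 : ∀ p, ∃ δ > 0, ∀ s s' : I, |(s : ℝ) - s'| < δ → |r p s - r p s'| < η := fun p => by
      have := CompactSpace.uniformContinuous_of_continuous (hr p)
      obtain ⟨δ, hδ, H⟩ := Metric.uniformContinuous_iff.1 this η hη
      exact ⟨δ, hδ, fun s s' hs => H hs⟩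
    choose δ hδ H using h1
    have h2 : ∀ᶠ x : ℝ in 𝓝[>] 0, ∀ p, x < δ p := by
      rw [eventually_all]
      exact fun p => nhdsWithin_le_nhds (Iio_mem_nhds (hδ p))
    obtain ⟨x, hx, hx0⟩ := (h2.and self_mem_nhdsWithin).exists
    exact ⟨x, hx0, fun p s s' hs => (H p s s' (hs.trans_lt (hx p))).le⟩
  obtain ⟨δ, hδ, hmod⟩ := hmod
  have h3 : ∀ᶠ i in l, ∀ p, ∀ s, |r p s - r' i p s| < η :=
    eventually_all.2 fun p => Metric.tendstoUniformly_iff.1 (hr' p) η hη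
  have h4 : ∀ᶠ n : ℕ in atTop, 1 / (n : ℝ) ≤ δ :=
    tendsto_one_div_atTop_nhds_zero_nat.eventually (ge_mem_nhds hδ)
  filter_upwards [h3, hN.eventually h4, hN.eventually (eventually_ge_atTop 2)] with i hi3 hi4 hi2
  rw [Real.dist_eq]
  refine (abs_sqrt_gridStatSq_sub_limitStat_le hh hr hr1 (η := 2 * η) (by positivity)
    (fun p s s' hs => (hmod p s s' hs).trans (by linarith)) (fun p s s' hs => ?_) hi2 hi4).trans_lt
    hsmall
  calc |r p s - r' i p s'| = |(r p s - r p s') + (r p s' - r' i p s')| := by ring_nf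
    _ ≤ |r p s - r p s'| + |r p s' - r' i p s'| := abs_add_le _ _
    _ ≤ 2 * η := by linarith [hmod p s s' hs, hi3 p s']

end Analysis

/-! ### The statistic as a functional of the partial-sum path -/

section Algebra

variable {H : Type*} [NormedAddCommGroup H] [InnerProductSpace ℝ H]

/-- The scalar bridge `s ↦ ⟪f s - s f 1, u⟫` built from a path `f` and a direction `u`. -/
noncomputable def bridgePath (f : I → H) (u : H) (s : I) : ℝ := ⟪f s - (s : ℝ) • f 1, u⟫

theorem bridgePath_eq (f : I → H) (x : H) (t : I) :
    bridgePath f x t = ⟪f t, x⟫ - t * ⟪f 1, x⟫ := by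
  simp [bridgePath, inner_sub_left, inner_smul_left]

@[simp] theorem bridgePath_one (f : I → H) (u : H) : bridgePath f u 1 = 0 := by
  simp [bridgePath]

theorem bridgePath_smul (f : I → H) (c : ℝ) (u : H) (s : I) :
    bridgePath f (c • u) s = c * bridgePath f u s := by
  simp [bridgePath, inner_smul_right]

theorem continuous_bridgePath {f : I → H} (hf : Continuous f) (u : H) :
    Continuous (bridgePath f u) := by
  unfold bridgePath
  fun_prop

theorem stieltjesSum_const_mul (h : ℝ → ℝ) (n k : ℕ) (c : ℝ) (r : I → ℝ) :
    stieltjesSum h n k (fun s => c * r s) = c * stieltjesSum h n k r := by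
  simp [stieltjesSum, Finset.mul_sum, mul_assoc]

theorem sum_range_mul_sub_by_parts (F D : ℕ → ℝ) (m : ℕ) :
    ∑ j ∈ Finset.range m, F (j + 1) * (D (j + 1) - D j) =
      F m * D m - F 0 * D 0 - ∑ j ∈ Finset.range m, D j * (F (j + 1) - F j) := by
  induction m with
  | zero => simp
  | succ m ih => rw [Finset.sum_range_succ, Finset.sum_range_succ, ih]; ring

theorem bridgePath_partialSumPath (e : ℤ → H) {n i : ℕ} (hn : 0 < n) (hi : i ≤ n) (u : H) :
    bridgePath (partialSumPath e n) u (projIcc 0 1 zero_le_one ((i : ℝ) / n)) =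
      (√(n : ℝ))⁻¹ * (∑ j ∈ Finset.Icc 1 i, ⟪e (j : ℤ), u⟫ -
        (i : ℝ) / n * ∑ j ∈ Finset.Icc 1 n, ⟪e (j : ℤ), u⟫) := by
  have hn' : (0 : ℝ) < n := by exact_mod_cast hn
  have hmem : (i : ℝ) / n ∈ Icc (0 : ℝ) 1 :=
    ⟨by positivity, (div_le_one hn').2 (by exact_mod_cast hi)⟩
  rw [projIcc_of_mem _ hmem]
  have h1 : (i : ℝ) / n * n = i := by field_simp
  simp only [bridgePath, partialSumPath, h1, Nat.floor_natCast, Set.Icc.coe_one, one_mul,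
    inner_sub_left, inner_smul_left, sum_inner, RCLike.conj_to_real]
  ring

/-- Summation by parts: the weighted sum of centred scores is a Riemann–Stieltjes sum of the bridge
of the partial sums. -/
theorem sum_weight_mul_centred (h : ℝ → ℝ) (h0 : ∀ x ∈ Icc (-1 : ℝ) 0, h x = 0) (e : ℤ → H)
    (u : H) {n k : ℕ} (hk : k < n) :
    ∑ i ∈ Finset.Icc 1 n, h (((i : ℝ) - k) / n) *
      (⟪e (i : ℤ), u⟫ - 1 / (n : ℝ) * ∑ j ∈ Finset.Icc 1 n, ⟪e (j : ℤ), u⟫) =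
      -(√(n : ℝ) * stieltjesSum h n k (bridgePath (partialSumPath e n) u)) := by
  have hn : 0 < n := by omega
  have hn' : (0 : ℝ) < n := by exact_mod_cast hn
  obtain ⟨m, rfl⟩ := Nat.exists_eq_add_of_lt hk
  set n := k + m + 1 with hndef
  set S : ℝ := ∑ j ∈ Finset.Icc 1 n, ⟪e (j : ℤ), u⟫ with hS
  set C : ℕ → ℝ := fun i => ∑ j ∈ Finset.Icc 1 i, ⟪e (j : ℤ), u⟫ - (i : ℝ) / n * S with hC
  have hCn : C n = 0 := by simp [hC, hS, hn'.ne']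
  have hstep : ∀ i : ℕ, ⟪e ((i + 1 : ℕ) : ℤ), u⟫ - 1 / (n : ℝ) * S = C (i + 1) - C i := by
    intro i
    simp only [hC]
    rw [Finset.sum_Icc_succ_top (by omega)]
    push_cast
    ring
  have hr : ∀ j, k + j ≤ n → √(n : ℝ) * bridgePath (partialSumPath e n) u
      (projIcc 0 1 zero_le_one (((k : ℝ) + j) / n)) = C (k + j) := by
    intro j hj
    have := bridgePath_partialSumPath e hn hj u
    push_cast at this
    rw [this, ← mul_assoc, mul_inv_cancel₀ (Real.sqrt_ne_zero'.2 hn'), one_mul]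
    simp only [hC]
    push_cast
    rfl
  set F : ℕ → ℝ := fun j => h ((j : ℝ) / n) with hF
  have hF0 : F 0 = 0 := by simpa [hF] using h0 0 (by simp)
  have hleft : ∑ i ∈ Finset.Icc 1 n, h (((i : ℝ) - k) / n) * (⟪e (i : ℤ), u⟫ - 1 / (n : ℝ) * S) =
      ∑ j ∈ Finset.range (m + 1), F (j + 1) * (C (k + (j + 1)) - C (k + j)) := by
    have hshift : ∀ G : ℕ → ℝ, ∑ i ∈ Finset.Icc 1 n, G i = ∑ i ∈ Finset.range n, G (i + 1) := by
      intro G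
      rw [Finset.range_eq_Ico, Finset.sum_Ico_add' G 0 n 1]
      rfl
    rw [hshift, hndef, add_assoc k m 1, Finset.sum_range_add, Finset.sum_eq_zero, zero_add]
    · refine Finset.sum_congr rfl fun j _ => ?_
      rw [← add_assoc k m 1, ← hndef, hstep, add_assoc k j 1]
      simp only [hF]
      push_cast
      ring_nf
    · intro i hi
      have hik : ((i : ℝ) + 1) ≤ k := by exact_mod_cast Finset.mem_range.1 hi
      have hkn : (k : ℝ) ≤ n := by exact_mod_cast hk.le
      rw [← add_assoc k m 1, ← hndef, h0, zero_mul]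
      push_cast
      constructor
      · rw [le_div_iff₀ hn']
        linarith [(Nat.cast_nonneg i : (0 : ℝ) ≤ i)]
      · exact div_nonpos_of_nonpos_of_nonneg (by linarith) hn'.le
  have hright : √(n : ℝ) * stieltjesSum h n k (bridgePath (partialSumPath e n) u) =
      ∑ j ∈ Finset.range (m + 1), C (k + j) * (F (j + 1) - F j) := by
    have hvanish : ∀ j ∈ Finset.range n, j ∉ Finset.range (m + 1) →
        bridgePath (partialSumPath e n) u (projIcc 0 1 zero_le_one (((k : ℝ) + j) / n)) *
          (h (((j : ℝ) + 1) / n) - h ((j : ℝ) / n)) = 0 := by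
      intro j _ hj
      have h1 : n ≤ k + j := by
        rw [Finset.mem_range] at hj
        omega
      rw [projIcc_of_right_le _ ((one_le_div hn').2 (by exact_mod_cast h1))]
      exact mul_eq_zero_of_left (bridgePath_one _ _) _
    rw [stieltjesSum, ← Finset.sum_subset (Finset.range_subset_range.2 (by omega)) hvanish,
      Finset.mul_sum]
    refine Finset.sum_congr rfl fun j hj => ?_
    rw [Finset.mem_range] at hj
    rw [← mul_assoc, hr j (by omega)]
    simp [hF]
  rw [hleft, hright, sum_range_mul_sub_by_parts F (fun j => C (k + j))]
  simp only [hF0, zero_mul, sub_zero]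
  rw [show k + (m + 1) = n by omega, hCn]
  simp

/-- Under a constant mean, the test statistic is the discrete functional of the bridges of the
partial-sum path in the directions `(√λ_p)⁻¹ s_p v_p`, whatever the signs `s_p`. -/
theorem gradualPCStat_eq {d : ℕ} {h : ℝ → ℝ} (h0 : ∀ x ∈ Icc (-1 : ℝ) 0, h x = 0) (e : ℤ → H)
    {n : ℕ} {X : ℕ → H} {m : H} (hX : ∀ i ∈ Finset.Icc 1 n, X i = m + e i) {lam s : Fin d → ℝ}
    (hlam : ∀ p, 0 < lam p) (hs : ∀ p, s p ^ 2 = 1) (v : Fin d → H) :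
    gradualPCStat h n X lam v = √(gridStatSq h n fun p =>
      bridgePath (partialSumPath e n) ((√(lam p))⁻¹ • s p • v p)) := by
  rw [gradualPCStat, gradualPCStatSq, gridStatSq]
  congr 1
  refine iSup_congr fun k => Finset.sum_congr rfl fun p _ => ?_
  obtain ⟨k, hk⟩ := k
  have hkn : k < n := (Finset.mem_Ico.1 hk).2
  have hn' : (0 : ℝ) < n := by exact_mod_cast (Nat.zero_le k).trans_lt hkn
  have h1 : ∀ i ∈ Finset.Icc 1 n, ⟪X i, v p⟫ - (1 / (n : ℝ)) * ∑ j ∈ Finset.Icc 1 n, ⟪X j, v p⟫ =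
      ⟪e (i : ℤ), v p⟫ - 1 / (n : ℝ) * ∑ j ∈ Finset.Icc 1 n, ⟪e (j : ℤ), v p⟫ := by
    intro i hi
    have h2 : ∑ j ∈ Finset.Icc 1 n, ⟪X j, v p⟫ =
        n * ⟪m, v p⟫ + ∑ j ∈ Finset.Icc 1 n, ⟪e (j : ℤ), v p⟫ := by
      rw [Finset.sum_congr rfl fun j hj => by rw [hX j hj, inner_add_left],
        Finset.sum_add_distrib]
      simp
    rw [h2, hX i hi, inner_add_left]
    field_simp
    ring
  rw [Finset.sum_congr rfl fun i hi => by rw [h1 i hi], sum_weight_mul_centred h h0 e (v p) hkn]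
  have h5 : bridgePath (partialSumPath e n) ((√(lam p))⁻¹ • s p • v p) =
      fun t => (√(lam p))⁻¹ * (s p * bridgePath (partialSumPath e n) (v p) t) := by
    ext t
    rw [bridgePath_smul, bridgePath_smul]
  rw [h5, stieltjesSum_const_mul h n k _ fun t => s p * bridgePath (partialSumPath e n) (v p) t,
    stieltjesSum_const_mul]
  have h3 : √(n : ℝ) ^ 2 = n := Real.sq_sqrt hn'.le
  have h4 : √(lam p) ^ 2 = lam p := Real.sq_sqrt (hlam p).le
  rw [neg_sq, mul_pow, mul_pow, mul_pow, hs, h3, inv_pow, h4]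
  field_simp

end Algebra

/-! ### Skorokhod convergence to a continuous path -/

/-- Convergence to a continuous path in the Skorokhod `J₁` topology is uniform. -/
theorem CadlagPath.tendstoUniformly_of_continuous {E : Type*} [PseudoMetricSpace E]
    {f₀ : CadlagPath E} (hf₀ : Continuous f₀) :
    TendstoUniformly (fun (f : CadlagPath E) t => f t) f₀ (𝓝 f₀) := by
  rw [Metric.tendstoUniformly_iff]
  intro ε hε
  obtain ⟨δ, hδ, H⟩ := Metric.uniformContinuous_iff.1
    (CompactSpace.uniformContinuous_of_continuous hf₀) (ε / 2) (by positivity)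
  have hball : Metric.eball f₀ (ENNReal.ofReal (min δ (ε / 2))) ∈ 𝓝 f₀ :=
    Metric.eball_mem_nhds _ (by simp [hδ, hε])
  filter_upwards [hball] with f hf t
  rw [Metric.mem_eball, CadlagPath.edist_def, iInf_lt_iff] at hf
  obtain ⟨φ, hφ⟩ := hf
  have h1 : dist (φ t) t < min δ (ε / 2) := by
    rw [← edist_lt_ofReal]
    exact ((le_iSup (fun t => edist (φ t) t) t).trans le_sup_left).trans_lt hφ
  have h2 : dist (f t) (f₀ (φ t)) < min δ (ε / 2) := by
    rw [← edist_lt_ofReal]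
    exact ((le_iSup (fun t => edist (f t) (f₀ (φ t))) t).trans le_sup_right).trans_lt hφ
  have h3 := H (h1.trans_le (min_le_left _ _))
  calc dist (f₀ t) (f t) ≤ dist (f₀ t) (f₀ (φ t)) + dist (f₀ (φ t)) (f t) := dist_triangle _ _ _
    _ < ε / 2 + ε / 2 := by
        rw [dist_comm (f₀ t), dist_comm (f₀ (φ t)) (f t)]
        exact add_lt_add h3 (h2.trans_le (min_le_right _ _))
    _ = ε := add_halves ε

/-- The bridges depend continuously, for uniform convergence, on the path in the Skorokhod topology
and on the direction, at continuous paths. -/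
theorem tendstoUniformly_bridgePath {H : Type*} [NormedAddCommGroup H] [InnerProductSpace ℝ H]
    {f₀ : CadlagPath H} (hf₀ : Continuous f₀) (u₀ : H) :
    TendstoUniformly (fun (q : CadlagPath H × H) => bridgePath q.1 q.2) (bridgePath f₀ u₀)
      (𝓝 f₀ ×ˢ 𝓝 u₀) := by
  rw [Metric.tendstoUniformly_iff]
  intro ε hε
  obtain ⟨M, hM⟩ := isCompact_univ.exists_bound_of_continuousOn
    (f := fun s : I => f₀ s - (s : ℝ) • f₀ 1) (by fun_prop)
  have hlim : Tendsto (fun δ : ℝ => 2 * δ * (‖u₀‖ + δ) + M * δ) (𝓝[>] 0) (𝓝 0) := by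
    have : Continuous fun δ : ℝ => 2 * δ * (‖u₀‖ + δ) + M * δ := by fun_prop
    simpa using (this.tendsto 0).mono_left nhdsWithin_le_nhds
  obtain ⟨δ, hδε, hδ⟩ := ((hlim.eventually (gt_mem_nhds hε)).and self_mem_nhdsWithin).exists
  have hδ : 0 < δ := hδ
  have h1 := Metric.tendstoUniformly_iff.1 (CadlagPath.tendstoUniformly_of_continuous hf₀) δ hδ
  have h2 : ∀ᶠ u in 𝓝 u₀, ‖u - u₀‖ < δ := by
    filter_upwards [Metric.ball_mem_nhds u₀ hδ] with u hu
    rwa [mem_ball_iff_norm] at hu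
  filter_upwards [h1.prod_mk h2] with q hq s
  obtain ⟨f, u⟩ := q
  obtain ⟨hf, hu⟩ := hq
  have hf' : ∀ t, ‖f t - f₀ t‖ < δ := fun t => by rw [← dist_eq_norm, dist_comm]; exact hf t
  have hu : ‖u - u₀‖ < δ := hu
  set a := f s - (s : ℝ) • f 1
  set a₀ := f₀ s - (s : ℝ) • f₀ 1 with ha₀
  have ha : ‖a - a₀‖ ≤ 2 * δ := by
    have : a - a₀ = (f s - f₀ s) - (s : ℝ) • (f 1 - f₀ 1) := by
      simp only [a, a₀, smul_sub]
      abel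
    rw [this]
    refine (norm_sub_le _ _).trans ?_
    rw [norm_smul, Real.norm_of_nonneg s.2.1]
    have := mul_le_of_le_one_left (norm_nonneg (f 1 - f₀ 1)) s.2.2
    linarith [hf' s, hf' 1]
  have hun : ‖u‖ ≤ ‖u₀‖ + δ := by
    have := norm_add_le u₀ (u - u₀)
    rw [add_sub_cancel] at this
    linarith
  change dist ⟪a₀, u₀⟫ ⟪a, u⟫ < ε
  rw [dist_comm, Real.dist_eq]
  calc |⟪a, u⟫ - ⟪a₀, u₀⟫| = |⟪a - a₀, u⟫ + ⟪a₀, u - u₀⟫| := by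
        rw [inner_sub_left a a₀ u, inner_sub_right a₀ u u₀, sub_add_sub_cancel]
    _ ≤ |⟪a - a₀, u⟫| + |⟪a₀, u - u₀⟫| := abs_add_le _ _
    _ ≤ ‖a - a₀‖ * ‖u‖ + ‖a₀‖ * ‖u - u₀‖ :=
        add_le_add (abs_real_inner_le_norm _ _) (abs_real_inner_le_norm _ _)
    _ ≤ 2 * δ * (‖u₀‖ + δ) + M * δ := by
        have hMs : ‖a₀‖ ≤ M := hM s (mem_univ s)
        gcongr
        exact (norm_nonneg _).trans hMs
    _ < ε := hδε

/-! ### An extended continuous mapping theorem -/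

/-- Suppose that `S n` converges in distribution to `W`, and that, up to events of vanishing
probability, `T n` has the form `Ψ n (S n) u` with a random `u` in an arbitrarily small neighbourhood
of `u₀`. If `Ψ n f u → F (W ω)` as `n → ∞`, `f → W ω` and `u → u₀`, for almost every `ω`, then
`T n` converges in distribution to `F ∘ W`. -/
theorem tendstoInDistribution_of_tendsto_nhds_ae {D 𝕐 Ω Ω' : Type*} [PseudoEMetricSpace D]
    [MeasurableSpace D] [BorelSpace D] [TopologicalSpace 𝕐] [FirstCountableTopology 𝕐]
    [MeasurableSpace Ω] {P : Measure Ω} [IsProbabilityMeasure P] [MeasurableSpace Ω']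
    {P' : Measure Ω'} [IsProbabilityMeasure P'] {S : ℕ → Ω → D} {W : Ω' → D}
    (hS : TendstoInDistribution S atTop W (fun _ => P) P') {Ψ : ℕ → D → 𝕐 → ℝ} {F : D → ℝ} {u₀ : 𝕐}
    (hΨ : ∀ᵐ ω ∂P', Tendsto (fun q : ℕ × D × 𝕐 => Ψ q.1 q.2.1 q.2.2)
      (atTop ×ˢ 𝓝 (W ω) ×ˢ 𝓝 u₀) (𝓝 (F (W ω)))) {T : ℕ → Ω → ℝ} (hT : ∀ n, AEMeasurable (T n) P)
    (hF : AEMeasurable (fun ω => F (W ω)) P')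
    (hbad : ∀ V ∈ 𝓝 u₀, Tendsto (fun n => P {ω | ¬ ∃ u ∈ V, T n ω = Ψ n (S n ω) u}) atTop (𝓝 0)) :
    TendstoInDistribution T atTop (fun ω => F (W ω)) (fun _ => P) P' := by
  refine ⟨hT, hF, tendsto_of_forall_isClosed_limsup_le' fun C hC => ?_⟩
  change limsup (fun n => P.map (T n) C) atTop ≤ P'.map (fun ω => F (W ω)) C
  obtain ⟨V, hV⟩ := (𝓝 u₀).exists_antitone_basis
  -- the paths that a value in `C` does not yet exclude at stage `j`
  set A : ℕ → Set D := fun j => closure {f | ∃ n ≥ j, ∃ u ∈ V j, Ψ n f u ∈ C} with hA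
  have hAclosed : ∀ j, IsClosed (A j) := fun j => isClosed_closure
  have hAanti : Antitone A := fun i j hij => closure_mono fun f ⟨n, hn, u, hu, h⟩ =>
    ⟨n, hij.trans hn, u, hV.antitone hij hu, h⟩
  have hstage : ∀ j, limsup (fun n => P.map (T n) C) atTop ≤ P'.map W (A j) := by
    intro j
    have h1 : ∀ᶠ n in atTop, P.map (T n) C ≤
        P.map (S n) (A j) + P {ω | ¬ ∃ u ∈ V j, T n ω = Ψ n (S n ω) u} := by
      filter_upwards [eventually_ge_atTop j] with n hn
      rw [Measure.map_apply_of_aemeasurable (hT n) hC.measurableSet,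
        Measure.map_apply_of_aemeasurable (hS.forall_aemeasurable n) (hAclosed j).measurableSet]
      refine (measure_mono fun ω hω => ?_).trans (measure_union_le _ _)
      by_cases hu : ∃ u ∈ V j, T n ω = Ψ n (S n ω) u
      · obtain ⟨u, huV, hu⟩ := hu
        refine Or.inl (subset_closure ⟨n, hn, u, huV, ?_⟩)
        rw [← hu]
        exact hω
      · exact Or.inr hu
    calc limsup (fun n => P.map (T n) C) atTop
        ≤ limsup ((fun n => P.map (S n) (A j)) +
            fun n => P {ω | ¬ ∃ u ∈ V j, T n ω = Ψ n (S n ω) u}) atTop := limsup_le_limsup h1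
      _ = limsup (fun n => P.map (S n) (A j)) atTop :=
          ENNReal.limsup_add_of_right_tendsto_zero (hbad _ (hV.mem j)) _
      _ ≤ P'.map W (A j) :=
          ProbabilityMeasure.limsup_measure_closed_le_of_tendsto hS.tendsto (hAclosed j)
  have hlim : Tendsto (fun j => P'.map W (A j)) atTop (𝓝 (P'.map W (⋂ j, A j))) :=
    tendsto_measure_iInter_atTop (fun j => (hAclosed j).measurableSet.nullMeasurableSet) hAanti
      ⟨0, measure_ne_top _ _⟩
  refine (ge_of_tendsto' hlim hstage).trans ?_
  rw [Measure.map_apply_of_aemeasurable hF hC.measurableSet,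
    Measure.map_apply_of_aemeasurable hS.aemeasurable_limit
      (isClosed_iInter hAclosed).measurableSet]
  refine measure_mono_ae ?_
  filter_upwards [hΨ] with ω hω hmem
  by_contra hnot
  have h1 := hω.eventually (hC.isOpen_compl.mem_nhds hnot)
  obtain ⟨pa, hpa, pb, hpb, h2⟩ := eventually_prod_iff.1 h1
  obtain ⟨pf, hpf, pu, hpu, h3⟩ := eventually_prod_iff.1 hpb
  obtain ⟨N, hN⟩ := eventually_atTop.1 hpa
  obtain ⟨j, hj⟩ := hV.mem_iff.1 hpu
  have hj' : V (max N j) ⊆ {u | pu u} := (hV.antitone (le_max_right _ _)).trans hj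
  obtain ⟨f, hf, n, hn, u, hu, hC'⟩ := mem_closure_iff_nhds.1 (mem_iInter.1 hmem (max N j)) _ hpf
  exact h2 (hN n ((le_max_left _ _).trans hn)) (h3 hf (hj' hu)) hC'

/-! ### Brownian bridges -/

section Gaussian

variable {Ω Ω' : Type*} [MeasurableSpace Ω] [MeasurableSpace Ω'] {P : Measure Ω} {P' : Measure Ω'}

/-- Gaussian vectors with the same means and covariances have the same law. -/
theorem ProbabilityTheory.HasGaussianLaw.map_eq_of_covariance_eq {J : Type*} [Fintype J] {X : Ω → J → ℝ}
    {Y : Ω' → J → ℝ} (hX : HasGaussianLaw X P) (hY : HasGaussianLaw Y P')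
    (hmean : ∀ j, ∫ ω, X ω j ∂P = ∫ ω, Y ω j ∂P')
    (hcov : ∀ i j, cov[fun ω => X ω i, fun ω => X ω j; P] =
      cov[fun ω => Y ω i, fun ω => Y ω j; P']) :
    P.map X = P'.map Y := by
  classical
  have := hX.isProbabilityMeasure
  have := hY.isProbabilityMeasure
  have := Measure.isProbabilityMeasure_map hX.aemeasurable
  have := Measure.isProbabilityMeasure_map hY.aemeasurable
  have hX2 : ∀ j, MemLp (fun ω => X ω j) 2 P := fun j =>
    (hX.map (ContinuousLinearMap.proj j)).memLp_two
  have hY2 : ∀ j, MemLp (fun ω => Y ω j) 2 P' := fun j =>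
    (hY.map (ContinuousLinearMap.proj j)).memLp_two
  refine Measure.ext_of_charFunDual ?_
  ext L
  have hL : ∀ x : J → ℝ, L x = ∑ j, L (fun i => if j = i then 1 else 0) * x j := fun x =>
    (LinearMap.pi_apply_eq_sum_univ L.toLinearMap x).trans
      (Finset.sum_congr rfl fun j _ => mul_comm _ _)
  rw [hX.charFunDual_map_eq_fun, hY.charFunDual_map_eq_fun]
  simp only [hL (X _), hL (Y _)]
  rw [integral_finsetSum _ fun j _ => ((hX2 j).integrable (by norm_num)).const_mul _,
    integral_finsetSum _ fun j _ => ((hY2 j).integrable (by norm_num)).const_mul _,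
    variance_fun_sum fun j => (hX2 j).const_mul _, variance_fun_sum fun j => (hY2 j).const_mul _]
  simp only [integral_const_mul, hmean, covariance_const_mul_left, covariance_const_mul_right, hcov]

namespace IsBrownianBridge

variable {B : I → Ω → ℝ}

theorem memLp_two (hB : IsBrownianBridge B P) (t : I) : MemLp (B t) 2 P :=
  (hB.gaussian.hasGaussianLaw_eval t).memLp_two

/-- The time reversal of a Brownian bridge is a Brownian bridge. -/
theorem comp_symm (hB : IsBrownianBridge B P) : IsBrownianBridge (fun t => B (σ t)) P where
  gaussian := hB.gaussian.comp_right σ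
  mean t := hB.mean _
  cov s t := by
    rw [hB.cov, coe_symm_eq, coe_symm_eq]
    rcases le_total (s : ℝ) t with h | h
    · rw [min_eq_left h, min_eq_right (by linarith)]
      ring
    · rw [min_eq_right h, min_eq_left (by linarith)]
      ring
  cont := by
    filter_upwards [hB.cont] with ω hω
    exact hω.comp (by fun_prop)

/-- The endpoint has variance zero. -/
theorem ae_eq_zero_at_one (hB : IsBrownianBridge B P) : ∀ᵐ ω ∂P, B 1 ω = 0 := by
  have := hB.gaussian.isProbabilityMeasure
  have hvar : Var[B 1; P] = 0 := by
    rw [← covariance_self (hB.gaussian.aemeasurable 1), hB.cov]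
    simp
  filter_upwards [ae_eq_integral_of_variance_eq_zero (hB.memLp_two 1) hvar] with ω hω
  rw [hω, hB.mean]

/-- Independent Brownian bridges have the same joint finite-dimensional distributions. -/
theorem map_restrict_eq {d : ℕ} {B : Fin d → I → Ω → ℝ} {B' : Fin d → I → Ω' → ℝ}
    [IsProbabilityMeasure P] [IsProbabilityMeasure P']
    (hB : ∀ p, IsBrownianBridge (B p) P) (hBi : iIndepFun (fun p ω t => B p t ω) P)
    (hB' : ∀ p, IsBrownianBridge (B' p) P') (hBi' : iIndepFun (fun p ω t => B' p t ω) P')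
    (J : Finset I) :
    P.map (fun ω p => J.restrict (B p · ω)) = P'.map (fun ω p => J.restrict (B' p · ω)) := by
  have h1 : iIndepFun (fun p ω => J.restrict (B p · ω)) P :=
    hBi.comp (fun _ => J.restrict) fun _ => by fun_prop
  have h2 : iIndepFun (fun p ω => J.restrict (B' p · ω)) P' :=
    hBi'.comp (fun _ => J.restrict) fun _ => by fun_prop
  rw [(iIndepFun_iff_map_fun_eq_pi_map fun p =>
      ((hB p).gaussian.hasGaussianLaw J).aemeasurable).1 h1,
    (iIndepFun_iff_map_fun_eq_pi_map fun p =>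
      ((hB' p).gaussian.hasGaussianLaw J).aemeasurable).1 h2]
  congr 1
  ext1 p
  refine HasGaussianLaw.map_eq_of_covariance_eq ((hB p).gaussian.hasGaussianLaw J)
    ((hB' p).gaussian.hasGaussianLaw J) (fun j => ?_) fun i j => ?_
  · exact ((hB p).mean j).trans ((hB' p).mean j).symm
  · exact ((hB p).cov i j).trans ((hB' p).cov i j).symm

end IsBrownianBridge

end Gaussian

/-! ### The law of the limit functional -/

section Law

variable {Ω Ω' : Type*} [MeasurableSpace Ω] [MeasurableSpace Ω'] {P : Measure Ω} {P' : Measure Ω'}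
  {d : ℕ} {h : ℝ → ℝ}

theorem measurable_gridStatSq (h : ℝ → ℝ) (n : ℕ) :
    Measurable fun r : Fin d → I → ℝ => gridStatSq h n r := by
  unfold gridStatSq stieltjesSum
  refine Measurable.iSup fun k => ?_
  fun_prop

/-- The finitely many times at which `gridStatSq h n` reads its argument. -/
noncomputable def gridTimes (n : ℕ) : Finset I :=
  (Finset.range n ×ˢ Finset.range n).image fun q =>
    projIcc 0 1 zero_le_one (((q.1 : ℝ) + q.2) / n)

/-- The function equal to `z` on `J` and to `0` elsewhere. -/
noncomputable def extendByZero (J : Finset I) (z : Fin d → J → ℝ) (p : Fin d) (t : I) : ℝ :=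
  open scoped Classical in if ht : t ∈ J then z p ⟨t, ht⟩ else 0

theorem measurable_extendByZero (J : Finset I) :
    Measurable (extendByZero (d := d) J) := by
  refine measurable_pi_lambda _ fun p => measurable_pi_lambda _ fun t => ?_
  by_cases ht : t ∈ J
  · simp only [extendByZero, ht, dif_pos]
    fun_prop
  · simp only [extendByZero, ht, dif_neg, not_false_eq_true]
    fun_prop

theorem gridStatSq_extendByZero (h : ℝ → ℝ) (n : ℕ) (r : Fin d → I → ℝ) :
    gridStatSq h n (extendByZero (gridTimes n) fun p => (gridTimes n).restrict (r p)) =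
      gridStatSq h n r := by
  refine iSup_congr fun k => Finset.sum_congr rfl fun p _ => ?_
  congr 1
  refine Finset.sum_congr rfl fun j hj => ?_
  have hk := (Finset.mem_Ico.1 k.2).2
  have hmem : projIcc 0 1 zero_le_one ((((k : ℕ) : ℝ) + j) / n) ∈ gridTimes n :=
    Finset.mem_image.2 ⟨(k, j), Finset.mem_product.2 ⟨Finset.mem_range.2 hk, hj⟩, rfl⟩
  simp [extendByZero, hmem]

theorem aemeasurable_restrict {R : Fin d → I → Ω → ℝ} (hR : ∀ p t, AEMeasurable (R p t) P)
    (J : Finset I) : AEMeasurable (fun ω p => J.restrict (R p · ω)) P :=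
  aemeasurable_pi_lambda _ fun p => aemeasurable_pi_lambda _ fun t => hR p t

theorem aemeasurable_gridStat {R : Fin d → I → Ω → ℝ} (hR : ∀ p t, AEMeasurable (R p t) P) (n : ℕ) :
    AEMeasurable (fun ω => √(gridStatSq h n fun p t => R p t ω)) P := by
  have h2 := ((measurable_gridStatSq (d := d) h n).comp
    (measurable_extendByZero (gridTimes n))).comp_aemeasurable
    (aemeasurable_restrict hR (gridTimes n))
  refine (Real.continuous_sqrt.measurable.comp_aemeasurable h2).congr (ae_of_all _ fun ω => ?_)
  exact congrArg Real.sqrt (gridStatSq_extendByZero h n fun p t => R p t ω)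

/-- The discrete functionals of the bridges converge to the limit functional of the reversed bridges;
the reversal is undone in the end, as it preserves the law. -/
theorem ae_tendsto_gridStat (hh : IsGradualWeight h) {B : Fin d → I → Ω → ℝ}
    (hB : ∀ p, IsBrownianBridge (B p) P) :
    ∀ᵐ ω ∂P, Tendsto (fun n => √(gridStatSq h n fun p t => B p t ω)) atTop
      (𝓝 (limitStat hh fun p t => B p (σ t) ω)) := by
  filter_upwards [eventually_all.2 fun p => (hB p).cont,
    eventually_all.2 fun p => (hB p).ae_eq_zero_at_one] with ω h1 h2
  exact tendsto_sqrt_gridStatSq hh (N := fun n => n) tendsto_id (r := fun p t => B p t ω)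
    (r' := fun _ p t => B p t ω) h1 h2 fun p => Metric.tendstoUniformly_iff.2 fun ε hε =>
      Eventually.of_forall fun _ s => by rwa [dist_self]

theorem aemeasurable_limitStat (hh : IsGradualWeight h) {B : Fin d → I → Ω → ℝ}
    (hB : ∀ p, IsBrownianBridge (B p) P) :
    AEMeasurable (fun ω => limitStat hh fun p t => B p (σ t) ω) P :=
  aemeasurable_of_tendsto_metrizable_ae atTop
    (fun n => aemeasurable_gridStat (fun p t => (hB p).gaussian.aemeasurable t) n)
    (ae_tendsto_gridStat hh hB)

/-- The law of the limit functional is the same for all families of independent Brownian bridges: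
the discrete functionals, which depend on finitely many times, have the same laws and converge to
it almost surely. -/
theorem map_limitStat_eq [IsProbabilityMeasure P] [IsProbabilityMeasure P'] (hh : IsGradualWeight h) {B : Fin d → I → Ω → ℝ}
    {B' : Fin d → I → Ω' → ℝ} (hB : ∀ p, IsBrownianBridge (B p) P)
    (hBi : iIndepFun (fun p ω t => B p t ω) P) (hB' : ∀ p, IsBrownianBridge (B' p) P')
    (hBi' : iIndepFun (fun p ω t => B' p t ω) P') :
    P.map (fun ω => limitStat hh fun p t => B p (σ t) ω) =
      P'.map (fun ω => limitStat hh fun p t => B' p (σ t) ω) := by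
  have hm : ∀ n, AEMeasurable (fun ω => √(gridStatSq h n fun p t => B p t ω)) P := fun n =>
    aemeasurable_gridStat (fun p t => (hB p).gaussian.aemeasurable t) n
  have hm' : ∀ n, AEMeasurable (fun ω => √(gridStatSq h n fun p t => B' p t ω)) P' := fun n =>
    aemeasurable_gridStat (fun p t => (hB' p).gaussian.aemeasurable t) n
  have hlaw : ∀ n, P.map (fun ω => √(gridStatSq h n fun p t => B p t ω)) =
      P'.map (fun ω => √(gridStatSq h n fun p t => B' p t ω)) := by
    intro n
    have hg : Measurable fun z : Fin d → gridTimes n → ℝ =>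
        √(gridStatSq h n (extendByZero (gridTimes n) z)) :=
      Real.continuous_sqrt.measurable.comp
        ((measurable_gridStatSq (d := d) h n).comp (measurable_extendByZero (gridTimes n)))
    have h1 := congrArg (Measure.map fun z : Fin d → gridTimes n → ℝ =>
        √(gridStatSq h n (extendByZero (gridTimes n) z)))
      (IsBrownianBridge.map_restrict_eq hB hBi hB' hBi' (gridTimes n))
    rw [AEMeasurable.map_map_of_aemeasurable hg.aemeasurable (aemeasurable_restrict
        (fun p t => (hB p).gaussian.aemeasurable t) _),
      AEMeasurable.map_map_of_aemeasurable hg.aemeasurable (aemeasurable_restrict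
        (fun p t => (hB' p).gaussian.aemeasurable t) _)] at h1
    convert h1 using 2
    · ext ω
      exact congrArg Real.sqrt (gridStatSq_extendByZero h n fun p t => B p t ω).symm
    · ext ω
      exact congrArg Real.sqrt (gridStatSq_extendByZero h n fun p t => B' p t ω).symm
  have hlim := tendstoInDistribution_of_ae_tendsto hm (aemeasurable_limitStat hh hB)
    (ae_tendsto_gridStat hh hB)
  have hlim' := tendstoInDistribution_of_ae_tendsto hm' (aemeasurable_limitStat hh hB')
    (ae_tendsto_gridStat hh hB')
  refine tendstoInDistribution_unique _ hlim ⟨hm, hlim'.aemeasurable_limit,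
    (tendsto_congr fun n => Subtype.ext (hlaw n)).2 hlim'.tendsto⟩

end Law

/-! ### Bridges of the projections of a Hilbert-valued Brownian motion -/

namespace IsHilbertBrownianMotion

variable {H : Type*} [NormedAddCommGroup H] [InnerProductSpace ℝ H] [MeasurableSpace H]
  {Ω : Type*} [MeasurableSpace Ω] {P : Measure Ω} {C : H →L[ℝ] H} {W : I → Ω → H}

theorem hasLaw_inner (hW : IsHilbertBrownianMotion C W P) (t : I) (x : H) :
    HasLaw (fun ω => ⟪W t ω, x⟫) (gaussianReal 0 ((t : ℝ) * ⟪C x, x⟫).toNNReal) P := by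
  have h1 := hW.gaussian 0 t t.2.1 x
  have h2 : (fun ω => ⟪W t ω - W 0 ω, x⟫) =ᵐ[P] fun ω => ⟪W t ω, x⟫ := by
    filter_upwards [hW.zero] with ω hω
    rw [hω, sub_zero]
  simp only [Icc.coe_zero, sub_zero] at h1
  exact ⟨h1.aemeasurable.congr h2, by rw [← Measure.map_congr h2, h1.map_eq]⟩

theorem hasGaussianLaw_inner (hW : IsHilbertBrownianMotion C W P) (t : I) (x : H) :
    HasGaussianLaw (fun ω => ⟪W t ω, x⟫) P :=
  (hW.hasLaw_inner t x).hasGaussianLaw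

theorem memLp_inner (hW : IsHilbertBrownianMotion C W P) (t : I) (x : H) :
    MemLp (fun ω => ⟪W t ω, x⟫) 2 P :=
  (hW.hasGaussianLaw_inner t x).memLp_two

theorem integral_inner (hW : IsHilbertBrownianMotion C W P) (t : I) (x : H) :
    ∫ ω, ⟪W t ω, x⟫ ∂P = 0 := by
  rw [(hW.hasLaw_inner t x).integral_eq, integral_id_gaussianReal]

theorem variance_inner (hW : IsHilbertBrownianMotion C W P) (t : I) {x : H} (hx : 0 ≤ ⟪C x, x⟫) :
    Var[fun ω => ⟪W t ω, x⟫; P] = t * ⟪C x, x⟫ := by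
  rw [(hW.hasLaw_inner t x).variance_eq, variance_id_gaussianReal,
    Real.coe_toNNReal _ (mul_nonneg t.2.1 hx)]

variable {d : ℕ} {u : Fin d → H}

/-- The projections of a Brownian motion to finitely many directions form a Gaussian process. -/
theorem isGaussianProcess_inner [BorelSpace H] (hW : IsHilbertBrownianMotion C W P)
    (u : Fin d → H) : IsGaussianProcess (fun t ω (p : Fin d) => ⟪W t ω, u p⟫) P := by
  let L : H →L[ℝ] Fin d → ℝ := ContinuousLinearMap.pi fun p => (innerSL ℝ).flip (u p)
  have hL : HasIndepIncrements (fun t ω (p : Fin d) => ⟪W t ω, u p⟫) P := hW.indep.map L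
  refine hL.isGaussianProcess (fun t => ?_) ?_
  · have hm : AEMeasurable (fun ω (p : Fin d) => ⟪W t ω, u p⟫) P :=
      aemeasurable_pi_lambda _ fun p => (hW.hasLaw_inner t (u p)).aemeasurable
    refine ⟨isGaussian_of_isGaussian_map fun M => ?_⟩
    rw [AEMeasurable.map_map_of_aemeasurable (by fun_prop) hm]
    have hM : (M ∘ fun ω (p : Fin d) => ⟪W t ω, u p⟫) =
        fun ω => ⟪W t ω, ∑ p, M (fun i => if p = i then 1 else 0) • u p⟫ := by
      ext ω
      simp only [Function.comp_apply, inner_sum, inner_smul_right]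
      exact (LinearMap.pi_apply_eq_sum_univ M.toLinearMap _).trans
        (Finset.sum_congr rfl fun j _ => mul_comm _ _)
    rw [hM]
    exact (hW.hasGaussianLaw_inner t _).isGaussian_map
  · filter_upwards [hW.zero] with ω hω
    ext p
    change ⟪W 0 ω, u p⟫ = 0
    rw [hω, inner_zero_left]

/-- In directions `u p` that are orthonormal for the bilinear form `⟪C x, y⟫`, the projections are
uncorrelated standard Brownian motions. -/
theorem covariance_inner [BorelSpace H] (hW : IsHilbertBrownianMotion C W P)
    (hu : ∀ p q, ⟪C (u p), u q⟫ = if p = q then 1 else 0) (p q : Fin d) (s t : I) :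
    cov[fun ω => ⟪W s ω, u p⟫, fun ω => ⟪W t ω, u q⟫; P] =
      if p = q then min (s : ℝ) t else 0 := by
  have hP : IsProbabilityMeasure P := (hW.hasGaussianLaw_inner 0 0).isProbabilityMeasure
  -- at equal times, by polarization
  have hsame : ∀ (p q : Fin d) (s : I),
      cov[fun ω => ⟪W s ω, u p⟫, fun ω => ⟪W s ω, u q⟫; P] = if p = q then (s : ℝ) else 0 := by
    intro p q s
    have hself : ∀ p, Var[fun ω => ⟪W s ω, u p⟫; P] = s := fun p => by
      rw [hW.variance_inner s (by simp [hu]), hu, if_pos rfl, mul_one]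
    rcases eq_or_ne p q with rfl | hpq
    · rw [covariance_self (hW.hasLaw_inner s (u p)).aemeasurable, hself, if_pos rfl]
    · have h2 : ⟪C (u p + u q), u p + u q⟫ = 2 := by
        simp only [map_add, inner_add_left, inner_add_right, hu]
        norm_num [hpq, hpq.symm]
      have h3 := hW.variance_inner s (x := u p + u q) (by rw [h2]; norm_num)
      simp only [inner_add_right] at h3
      rw [variance_fun_add (hW.memLp_inner s _) (hW.memLp_inner s _), hself, hself] at h3
      rw [if_neg hpq]
      simp only [← inner_add_right, h2] at h3
      linarith
  -- at different times, since increments are independent of the past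
  have hle : ∀ (p q : Fin d) (s t : I), s ≤ t →
      cov[fun ω => ⟪W s ω, u p⟫, fun ω => ⟪W t ω, u q⟫; P] = if p = q then (s : ℝ) else 0 := by
    intro p q s t hst
    have hindep := (hW.indep.indepFun_eval_sub s.2.1 hst hW.zero).comp
      (φ := fun x => ⟪x, u p⟫) (ψ := fun x => ⟪x, u q⟫)
      (Continuous.measurable (by fun_prop)) (Continuous.measurable (by fun_prop))
    have h1 := hindep.covariance_eq_zero (hW.memLp_inner s (u p)) (by
      refine (hW.memLp_inner t (u q)).sub (hW.memLp_inner s (u q)) |>.ae_eq (ae_of_all _ fun ω => ?_)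
      simp [inner_sub_left])
    have h2 : (fun ω => ⟪W t ω, u q⟫) = (fun ω => ⟪W s ω, u q⟫) +
        ((fun x => ⟪x, u q⟫) ∘ (W t - W s)) := by
      ext ω
      simp [inner_sub_left]
    have h3 : MemLp ((fun x => ⟪x, u q⟫) ∘ (W t - W s)) 2 P := by
      refine (hW.memLp_inner t (u q)).sub (hW.memLp_inner s (u q)) |>.ae_eq (ae_of_all _ fun ω => ?_)
      simp [inner_sub_left]
    rw [h2, covariance_add_right (hW.memLp_inner s _) (hW.memLp_inner s _) h3, hsame]
    exact (add_eq_left.2 h1)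
  rcases le_total s t with hst | hst
  · rw [hle p q s t hst, min_eq_left (show (s : ℝ) ≤ t from hst)]
  · rw [covariance_comm, hle q p t s hst, min_eq_right (show (t : ℝ) ≤ s from hst)]
    simp only [eq_comm]

theorem covariance_bridgePath [BorelSpace H] (hW : IsHilbertBrownianMotion C W P)
    (hu : ∀ p q, ⟪C (u p), u q⟫ = if p = q then 1 else 0) (p q : Fin d) (s t : I) :
    cov[fun ω => bridgePath (W · ω) (u p) s, fun ω => bridgePath (W · ω) (u q) t; P] =
      if p = q then min (s : ℝ) t - s * t else 0 := by
  have hP : IsProbabilityMeasure P := (hW.hasGaussianLaw_inner 0 0).isProbabilityMeasure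
  have hm := fun t p => hW.memLp_inner t (u p)
  have hmq : MemLp (fun ω => ⟪W t ω, u q⟫ - t * ⟪W 1 ω, u q⟫) 2 P :=
    (hm t q).sub ((hm 1 q).const_mul _)
  simp only [bridgePath_eq]
  rw [covariance_fun_sub_left (hm s p) ((hm 1 p).const_mul _) hmq,
    covariance_fun_sub_right (hm s p) (hm t q) ((hm 1 q).const_mul _),
    covariance_fun_sub_right ((hm 1 p).const_mul _) (hm t q) ((hm 1 q).const_mul _)]
  simp only [covariance_const_mul_left, covariance_const_mul_right, hW.covariance_inner hu]
  split_ifs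
  · rw [Icc.coe_one, min_eq_left s.2.2, min_eq_right t.2.2, min_self]
    ring
  · ring

theorem isGaussianProcess_bridgePath [BorelSpace H] (hW : IsHilbertBrownianMotion C W P)
    (u : Fin d → H) :
    IsGaussianProcess (fun (q : (_ : Fin d) × I) ω => bridgePath (W · ω) (u q.1) q.2) P := by
  classical
  refine IsGaussianProcess.of_isGaussianProcess (hW.isGaussianProcess_inner u) fun q => ?_
  let L (i : ({q.2, 1} : Finset I)) : (({q.2, 1} : Finset I) → Fin d → ℝ) →L[ℝ] ℝ :=
    (ContinuousLinearMap.proj (R := ℝ) (φ := fun _ : Fin d => ℝ) q.1).comp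
      (ContinuousLinearMap.proj (R := ℝ) (φ := fun _ : ({q.2, 1} : Finset I) => Fin d → ℝ) i)
  refine ⟨{q.2, 1}, L ⟨q.2, by simp⟩ - (q.2 : ℝ) • L ⟨1, by simp⟩, fun ω => ?_⟩
  simp [bridgePath_eq, L]

theorem isBrownianBridge_bridgePath [BorelSpace H] (hW : IsHilbertBrownianMotion C W P)
    (hu : ∀ p q, ⟪C (u p), u q⟫ = if p = q then 1 else 0) (p : Fin d) :
    IsBrownianBridge (fun t ω => bridgePath (W · ω) (u p) t) P where
  gaussian := (hW.isGaussianProcess_bridgePath u).comp_right fun t => ⟨p, t⟩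
  mean t := by
    have hP : IsProbabilityMeasure P := (hW.hasGaussianLaw_inner 0 0).isProbabilityMeasure
    have hm := fun t => (hW.hasGaussianLaw_inner t (u p)).integrable
    simp only [bridgePath_eq]
    rw [integral_sub (hm t) ((hm 1).const_mul _), integral_const_mul, hW.integral_inner,
      hW.integral_inner]
    simp
  cov s t := by
    rw [hW.covariance_bridgePath hu, if_pos rfl]
  cont := by
    filter_upwards [hW.cont] with ω hω
    exact continuous_bridgePath hω _

theorem iIndepFun_bridgePath [BorelSpace H] (hW : IsHilbertBrownianMotion C W P)
    (hu : ∀ p q, ⟪C (u p), u q⟫ = if p = q then 1 else 0) :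
    iIndepFun (fun p ω t => bridgePath (W · ω) (u p) t) P :=
  IsGaussianProcess.iIndepFun_of_covariance_eq_zero
    (X := fun (p : Fin d) (t : I) ω => bridgePath (W · ω) (u p) t)
    (hW.isGaussianProcess_bridgePath u)
    (fun p t => (hW.isBrownianBridge_bridgePath hu p).gaussian.aemeasurable t)
    fun p q hpq s t => by rw [hW.covariance_bridgePath hu, if_neg hpq]

end IsHilbertBrownianMotion

/-! ### Convergence in distribution of the statistic -/

section Main

variable {H : Type*} [NormedAddCommGroup H] [InnerProductSpace ℝ H] {Ω : Type*} [MeasurableSpace Ω]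
  {P : Measure Ω} {d : ℕ}

theorem aemeasurable_gradualPCStat [SecondCountableTopology H] [MeasurableSpace H] [BorelSpace H]
    (h : ℝ → ℝ) (n : ℕ) {X : ℕ → Ω → H} (hX : ∀ i ∈ Finset.Icc 1 n, Measurable (X i))
    {lam : Fin d → Ω → ℝ} (hlam : ∀ p, Measurable (lam p)) {v : Fin d → Ω → H}
    (hv : ∀ p, Measurable (v p)) :
    AEMeasurable (fun ω => gradualPCStat h n (fun i => X i ω) (fun p => lam p ω)
      (fun p => v p ω)) P := by
  have hs : ∀ p, ∀ i ∈ Finset.Icc 1 n, Measurable fun ω => ⟪X i ω, v p ω⟫ := fun p i hi =>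
    (hX i hi).inner (hv p)
  have hmean : ∀ p, Measurable fun ω => ∑ j ∈ Finset.Icc 1 n, ⟪X j ω, v p ω⟫ := fun p =>
    Finset.measurable_fun_sum _ fun j hj => hs p j hj
  refine (Measurable.sqrt ?_).aemeasurable
  refine Measurable.iSup fun k => Finset.measurable_fun_sum _ fun p _ => ?_
  refine (((hlam p).const_div 1).mul_const _).mul (Measurable.pow_const ?_ 2)
  exact Finset.measurable_fun_sum _ fun i hi =>
    ((hs p i hi).sub ((hmean p).const_mul _)).const_mul _

/-- With probability tending to one, the estimated eigenvalues are positive, the signs are not zero,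
and the rescaled sign-adjusted estimated eigenvectors lie in a given neighbourhood of their limit. -/
theorem tendsto_measure_not_mem_nhds {lam : Fin d → ℝ} (hlam : ∀ p, 0 < lam p) {v : Fin d → H}
    {lamhat : ℕ → Fin d → Ω → ℝ} {vhat : ℕ → Fin d → Ω → H} {s : ℕ → Fin d → Ω → ℝ}
    (hs : ∀ n p ω, s n p ω = 0 ∨ s n p ω ^ 2 = 1)
    (hnorm : ∀ n, ∀ᵐ ω ∂P, ∀ p, ‖vhat n p ω‖ = 1)
    (hvhat : ∀ p, TendstoInMeasure P (fun n ω => vhat n p ω - s n p ω • v p) atTop (fun _ => 0))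
    (hlamhat : ∀ p, TendstoInMeasure P (fun n ω => lamhat n p ω - lam p) atTop (fun _ => 0))
    {V : Set (Fin d → H)} (hV : V ∈ 𝓝 fun p => (√(lam p))⁻¹ • v p) :
    Tendsto (fun n => P {ω | ¬ ((∀ p, 0 < lamhat n p ω) ∧ (∀ p, s n p ω ^ 2 = 1) ∧
      (fun p => (√(lamhat n p ω))⁻¹ • s n p ω • vhat n p ω) ∈ V)}) atTop (𝓝 0) := by
  -- a common radius on which positivity, non-vanishing signs and membership in `V` are ensured
  have hcont : Tendsto (fun q : (Fin d → ℝ) × (Fin d → H) => fun p => (√(q.1 p))⁻¹ • q.2 p)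
      (𝓝 (lam, v)) (𝓝 fun p => (√(lam p))⁻¹ • v p) := by
    refine tendsto_pi_nhds.2 fun p => ContinuousAt.tendsto (x := (lam, v)) ?_
    refine ContinuousAt.smul (ContinuousAt.inv₀ ?_ (Real.sqrt_ne_zero'.2 (hlam p))) (by fun_prop)
    exact (Real.continuous_sqrt.comp (by fun_prop)).continuousAt
  have hpos : ∀ᶠ q : (Fin d → ℝ) × (Fin d → H) in 𝓝 (lam, v), ∀ p, 0 < q.1 p :=
    eventually_all.2 fun p => (Continuous.continuousAt (by fun_prop)).eventually
      (lt_mem_nhds (hlam p))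
  obtain ⟨δ₀, hδ₀, hball⟩ := Metric.mem_nhds_iff.1 (hpos.and (hcont.eventually hV))
  set δ := min δ₀ 1 with hδ
  have hδ0 : 0 < δ := lt_min hδ₀ one_pos
  have hgood : ∀ n ω, (∀ p, ‖vhat n p ω‖ = 1) → (∀ p, ‖vhat n p ω - s n p ω • v p‖ < δ) →
      (∀ p, ‖lamhat n p ω - lam p‖ < δ) → (∀ p, 0 < lamhat n p ω) ∧ (∀ p, s n p ω ^ 2 = 1) ∧
      (fun p => (√(lamhat n p ω))⁻¹ • s n p ω • vhat n p ω) ∈ V := by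
    intro n ω h1 h2 h3
    have hs1 : ∀ p, s n p ω ^ 2 = 1 := fun p => (hs n p ω).resolve_left fun h0 => by
      have := h2 p
      rw [h0, zero_smul, sub_zero, h1] at this
      exact absurd this (not_lt.2 (min_le_right _ _))
    have hmem : ((fun p => lamhat n p ω, fun p => s n p ω • vhat n p ω) :
        (Fin d → ℝ) × (Fin d → H)) ∈ Metric.ball (lam, v) δ₀ := by
      rw [Metric.mem_ball, Prod.dist_eq, max_lt_iff, dist_pi_lt_iff hδ₀, dist_pi_lt_iff hδ₀]
      refine ⟨fun p => (h3 p).trans_le (min_le_left _ _), fun p => ?_⟩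
      have h4 : s n p ω • vhat n p ω - v p = s n p ω • (vhat n p ω - s n p ω • v p) := by
        rw [smul_sub, smul_smul, ← sq, hs1 p, one_smul]
      have h5 : |s n p ω| = 1 := by
        rw [← sq_eq_sq₀ (abs_nonneg _) zero_le_one, sq_abs, hs1, one_pow]
      rw [dist_eq_norm, h4, norm_smul, Real.norm_eq_abs, h5, one_mul]
      exact (h2 p).trans_le (min_le_left _ _)
    exact ⟨(hball hmem).1, hs1, (hball hmem).2⟩
  have hbound : ∀ n, P {ω | ¬ ((∀ p, 0 < lamhat n p ω) ∧ (∀ p, s n p ω ^ 2 = 1) ∧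
      (fun p => (√(lamhat n p ω))⁻¹ • s n p ω • vhat n p ω) ∈ V)} ≤
      ∑ p, P {ω | δ ≤ ‖vhat n p ω - s n p ω • v p - 0‖} +
        ∑ p, P {ω | δ ≤ ‖lamhat n p ω - lam p - 0‖} := by
    intro n
    calc _ ≤ P ((⋃ p, {ω | δ ≤ ‖vhat n p ω - s n p ω • v p - 0‖}) ∪
          ⋃ p, {ω | δ ≤ ‖lamhat n p ω - lam p - 0‖}) := by
          refine measure_mono_ae ?_
          filter_upwards [hnorm n] with ω hω hbad
          by_contra hcon
          simp only [sub_zero] at hcon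
          refine hbad (hgood n ω hω (fun p => ?_) fun p => ?_)
          · by_contra hc
            exact hcon (Or.inl (mem_iUnion.2 ⟨p, not_lt.1 hc⟩))
          · by_contra hc
            exact hcon (Or.inr (mem_iUnion.2 ⟨p, not_lt.1 hc⟩))
      _ ≤ _ := (measure_union_le _ _).trans
          (add_le_add (measure_iUnion_fintype_le _ _) (measure_iUnion_fintype_le _ _))
  have hlim : Tendsto (fun n => ∑ p, P {ω | δ ≤ ‖vhat n p ω - s n p ω • v p - 0‖} +
      ∑ p, P {ω | δ ≤ ‖lamhat n p ω - lam p - 0‖}) atTop (𝓝 0) := by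
    have h1 := tendsto_finsetSum (Finset.univ : Finset (Fin d)) fun p _ =>
      tendstoInMeasure_iff_norm.1 (hvhat p) δ hδ0
    have h2 := tendsto_finsetSum (Finset.univ : Finset (Fin d)) fun p _ =>
      tendstoInMeasure_iff_norm.1 (hlamhat p) δ hδ0
    simpa using h1.add h2
  exact tendsto_of_tendsto_of_tendsto_of_le_of_le tendsto_const_nhds hlim (fun _ => bot_le) hbound

theorem inner_apply_rescaled_eigenvectors {C : H →L[ℝ] H} {lam : Fin d → ℝ} (hlam : ∀ p, 0 < lam p)
    {v : Fin d → H} (hv : Orthonormal ℝ v) (hC : ∀ p, C (v p) = lam p • v p) (p q : Fin d) :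
    ⟪C ((√(lam p))⁻¹ • v p), (√(lam q))⁻¹ • v q⟫ = if p = q then 1 else 0 := by
  rw [map_smul, hC, inner_smul_left, inner_smul_left, inner_smul_right,
    orthonormal_iff_ite.1 hv]
  split_ifs with h
  · subst h
    have h1 : √(lam p) ≠ 0 := Real.sqrt_ne_zero'.2 (hlam p)
    have h2 := Real.mul_self_sqrt (hlam p).le
    simp only [RCLike.conj_to_real]
    field_simp
    nlinarith
  · simp

end Main

/-- Convergence in distribution only depends on the law of the limit. -/
theorem MeasureTheory.TendstoInDistribution.of_map_eq {ι E Ω' Ω'' : Type*} {Ω : ι → Type*}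
    {_ : ∀ i, MeasurableSpace (Ω i)} {μ : ∀ i, Measure (Ω i)} [∀ i, IsProbabilityMeasure (μ i)]
    {_ : MeasurableSpace Ω'} {P' : Measure Ω'} [IsProbabilityMeasure P'] {_ : MeasurableSpace Ω''}
    {P'' : Measure Ω''} [IsProbabilityMeasure P''] [TopologicalSpace E] [MeasurableSpace E]
    [OpensMeasurableSpace E] {l : Filter ι} {X : ∀ i, Ω i → E} {Z : Ω' → E} {Z' : Ω'' → E}
    (hX : TendstoInDistribution X l Z μ P') (hZ' : AEMeasurable Z' P'')
    (hlaw : P'.map Z = P''.map Z') : TendstoInDistribution X l Z' μ P'' := by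
  refine ⟨hX.forall_aemeasurable, hZ', ?_⟩
  have h1 : (⟨P'.map Z, Measure.isProbabilityMeasure_map hX.aemeasurable_limit⟩ :
      ProbabilityMeasure E) = ⟨P''.map Z', Measure.isProbabilityMeasure_map hZ'⟩ :=
    Subtype.ext hlaw
  exact h1 ▸ hX.tendsto

/-- The limit theorem in an arbitrary real inner product space with countable base, in terms of the
hypotheses that enter the argument. -/
theorem tendstoInDistribution_gradualPCStat {H : Type*} [NormedAddCommGroup H]
    [InnerProductSpace ℝ H] [SecondCountableTopology H] [MeasurableSpace H] [BorelSpace H]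
    {Ω : Type*} [MeasurableSpace Ω] (P : Measure Ω) [IsProbabilityMeasure P]
    (ε : ℤ → Ω → H) (hε_meas : ∀ i, Measurable (ε i)) (C : H →L[ℝ] H)
    {d : ℕ} (lam : Fin d → ℝ) (v : Fin d → H) (hv : Orthonormal ℝ v) (hlam_pos : ∀ p, 0 < lam p)
    (hCv : ∀ p, C (v p) = lam p • v p)
    {Ω' : Type*} [MeasurableSpace Ω'] (P' : Measure Ω') [IsProbabilityMeasure P']
    (W : Ω' → CadlagPath H) (hW : IsHilbertBrownianMotion C (fun t ω => W ω t) P')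
    (hFCLT : TendstoInDistribution (fun n ω => partialSumPath (fun i => ε i ω) n) atTop W
      (fun _ => P) P')
    (m : ℕ → ℕ → H) (X : ℕ → ℕ → Ω → H)
    (hX : ∀ n, ∀ i ∈ Finset.Icc 1 n, ∀ ω, X n i ω = m n i + ε i ω)
    (hH0 : ∀ n, ∀ i ∈ Finset.Icc 1 n, ∀ j ∈ Finset.Icc 1 n, m n i = m n j)
    (h : ℝ → ℝ) (hh : IsGradualWeight h)
    (lamhat : ℕ → Fin d → Ω → ℝ) (vhat : ℕ → Fin d → Ω → H)
    (hlamhat_meas : ∀ n p, Measurable (lamhat n p)) (hvhat_meas : ∀ n p, Measurable (vhat n p))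
    (hnorm : ∀ n, ∀ᵐ ω ∂P, ∀ p, ‖vhat n p ω‖ = 1)
    (hvhat : ∀ p, TendstoInMeasure P
      (fun n ω => vhat n p ω - Real.sign ⟪vhat n p ω, v p⟫ • v p) atTop (fun _ => 0))
    (hlamhat : ∀ p, TendstoInMeasure P (fun n ω => lamhat n p ω - lam p) atTop (fun _ => 0))
    {Ω'' : Type*} [MeasurableSpace Ω''] (P'' : Measure Ω'') [IsProbabilityMeasure P'']
    (B : Fin d → I → Ω'' → ℝ) (hB : ∀ p, IsBrownianBridge (B p) P'')
    (hB_indep : iIndepFun (fun p ω t => B p t ω) P'') :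
    TendstoInDistribution
      (fun n ω => gradualPCStat h n (fun i => X n i ω) (fun p => lamhat n p ω)
        (fun p => vhat n p ω))
      atTop
      (fun ω => ⨆ t : I, √(∑ p : Fin d, gradualLimitPath hh (fun s => B p s ω) t ^ 2))
      (fun _ => P) P'' := by
  have hh0 := hh.eq_zero
  -- the rescaled eigenvectors, which are orthonormal for the bilinear form of the covariance
  set u : Fin d → H := fun p => (√(lam p))⁻¹ • v p with hu_def
  have hu : ∀ p q, ⟪C (u p), u q⟫ = if p = q then 1 else 0 :=
    inner_apply_rescaled_eigenvectors hlam_pos hv hCv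
  have hbridge : ∀ p, IsBrownianBridge (fun t ω => bridgePath (W ω) (u p) t) P' :=
    hW.isBrownianBridge_bridgePath hu
  have hindep : iIndepFun (fun p ω t => bridgePath (W ω) (u p) t) P' := hW.iIndepFun_bridgePath hu
  -- the functional of the paths and of the directions that gives the statistic
  set Ψ : ℕ → CadlagPath H → (Fin d → H) → ℝ :=
    fun n f w => √(gridStatSq h n fun p => bridgePath f (w p)) with hΨ_def
  have hΨ : ∀ᵐ ω ∂P', Tendsto (fun q : ℕ × CadlagPath H × (Fin d → H) =>
      Ψ q.1 q.2.1 q.2.2) (atTop ×ˢ 𝓝 (W ω) ×ˢ 𝓝 u)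
      (𝓝 (limitStat hh fun p t => bridgePath (W ω) (u p) (σ t))) := by
    filter_upwards [hW.cont] with ω hω
    refine tendsto_sqrt_gridStatSq hh tendsto_fst
      (r := fun p => bridgePath (W ω) (u p))
      (r' := fun (q : ℕ × CadlagPath H × (Fin d → H)) p =>
        bridgePath q.2.1 (q.2.2 p))
      (fun p => continuous_bridgePath hω _) (fun p => bridgePath_one _ _) fun p => ?_
    have hproj : Tendsto (fun q : ℕ × CadlagPath H × (Fin d → H) =>
        (q.2.1, q.2.2 p)) (atTop ×ˢ 𝓝 (W ω) ×ˢ 𝓝 u) (𝓝 (W ω) ×ˢ 𝓝 (u p)) :=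
      (tendsto_fst.comp tendsto_snd).prodMk
        (((continuous_apply p).tendsto u).comp (tendsto_snd.comp tendsto_snd))
    exact fun V hV => hproj.eventually (tendstoUniformly_bridgePath hω (u p) V hV)
  have hT : ∀ n, AEMeasurable (fun ω => gradualPCStat h n (fun i => X n i ω)
      (fun p => lamhat n p ω) (fun p => vhat n p ω)) P := fun n =>
    aemeasurable_gradualPCStat h n (fun i hi => by
      rw [funext fun ω => hX n i hi ω]
      exact (hε_meas i).const_add _) (hlamhat_meas n) (hvhat_meas n)
  have hsign : ∀ x : ℝ, Real.sign x = 0 ∨ Real.sign x ^ 2 = 1 := fun x => by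
    rcases Real.sign_apply_eq x with hx | hx | hx <;> simp [hx]
  have hbad : ∀ V ∈ 𝓝 u, Tendsto (fun n => P {ω | ¬ ∃ w ∈ V, gradualPCStat h n
      (fun i => X n i ω) (fun p => lamhat n p ω) (fun p => vhat n p ω) =
        Ψ n (partialSumPath (fun i => ε i ω) n) w}) atTop (𝓝 0) := by
    intro V hV
    refine tendsto_of_tendsto_of_tendsto_of_le_of_le tendsto_const_nhds
      (tendsto_measure_not_mem_nhds hlam_pos (s := fun n p ω => Real.sign ⟪vhat n p ω, v p⟫) (fun n p ω => hsign _)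
        hnorm hvhat hlamhat hV)
      (fun _ => bot_le) fun n => measure_mono fun ω hω hgood => hω ?_
    exact ⟨_, hgood.2.2, gradualPCStat_eq hh0 (fun i => ε i ω) (m := m n 1) (fun i hi => by
      rw [hX n i hi, hH0 n i hi 1 (Finset.mem_Icc.2 ⟨le_rfl, (Finset.mem_Icc.1 hi).1.trans
        (Finset.mem_Icc.1 hi).2⟩)]) hgood.1 hgood.2.1 _⟩
  have hF : AEMeasurable (fun ω => limitStat hh fun p t => bridgePath (W ω) (u p) (σ t)) P' :=
    aemeasurable_limitStat hh (B := fun p t ω => bridgePath (W ω) (u p) t) hbridge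
  have hmain : TendstoInDistribution (fun n ω => gradualPCStat h n (fun i => X n i ω)
      (fun p => lamhat n p ω) (fun p => vhat n p ω)) atTop
      (fun ω => limitStat hh fun p t => bridgePath (W ω) (u p) (σ t)) (fun _ => P) P' :=
    tendstoInDistribution_of_tendsto_nhds_ae (Ψ := Ψ) (u₀ := u)
      (S := fun n ω => partialSumPath (fun i => ε i ω) n)
      (F := fun f => limitStat hh fun p t => bridgePath f (u p) (σ t)) hFCLT hΨ hT hF hbad
  -- the limit has the law of the functional of the given Brownian bridges
  have hB' : ∀ p, IsBrownianBridge (fun t => B p (σ t)) P'' := fun p => (hB p).comp_symm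
  have hBi' : iIndepFun (fun p ω t => B p (σ t) ω) P'' :=
    hB_indep.comp (fun _ b t => b (σ t)) fun _ => by fun_prop
  have hlaw := map_limitStat_eq hh (B := fun p t ω => bridgePath (W ω) (u p) t)
    (B' := fun p t => B p (σ t)) hbridge hindep hB' hBi'
  have hmeas := aemeasurable_limitStat hh (B := fun p t => B p (σ t)) hB'
  simp only [symm_symm] at hlaw hmeas
  exact hmain.of_map_eq hmeas hlaw

theorem mainTheorem4
    -- the Hilbert space `L²(𝒵, ν)`
    {𝒵 : Type*} [MeasurableSpace 𝒵] (ν : Measure 𝒵) [SigmaFinite ν]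
    [TopologicalSpace.SeparableSpace (Lp ℝ 2 ν)] [MeasurableSpace (Lp ℝ 2 ν)] [BorelSpace (Lp ℝ 2 ν)]
    {Ω : Type*} [MeasurableSpace Ω] (P : Measure Ω) [IsProbabilityMeasure P]
    -- the errors: centred, strictly stationary, with more than two moments, summable
    -- autocovariance operators and a long-run covariance operator that is not zero
    (ε : ℤ → Ω → Lp ℝ 2 ν) (hε_meas : ∀ i, Measurable (ε i))
    (hε_stat : StrictlyStationary ε P)
    (hε_moment : ∃ k : ℝ, 2 < k ∧ MemLp (ε 1) (ENNReal.ofReal k) P)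
    (hε_mean : ∫ ω, ε 1 ω ∂P = 0)
    (hC_summable : Summable fun r : ℤ => ‖lagCovOp ε P r‖)
    (hC_ne : longRunCovOp ε P ≠ 0)
    -- the spectral decomposition of the long-run covariance operator
    (lam : ℕ → ℝ) (v : ℕ → Lp ℝ 2 ν) (hlam : Antitone lam) (hv : Orthonormal ℝ v)
    (hspec : ∀ x, HasSum (fun p => lam p • InnerProductSpace.rankOne ℝ (v p) (v p) x)
      (longRunCovOp ε P x))
    (hcov : Summable fun q : ℕ × ℤ =>
      |cov[fun ω => ⟪ε 0 ω, v q.1⟫, fun ω => ⟪ε q.2 ω, v q.1⟫; P]|)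
    -- the functional central limit theorem for the errors, in the Skorokhod space
    {Ω' : Type*} [MeasurableSpace Ω'] (P' : Measure Ω') [IsProbabilityMeasure P']
    (W : Ω' → CadlagPath (Lp ℝ 2 ν))
    (hW : IsHilbertBrownianMotion (longRunCovOp ε P) (fun t ω => W ω t) P')
    (hFCLT : TendstoInDistribution (fun n ω => partialSumPath (fun i => ε i ω) n) atTop W
      (fun _ => P) P')
    -- the observations for sample size `n`, under the null hypothesis of a constant mean
    (m : ℕ → ℕ → Lp ℝ 2 ν) (X : ℕ → ℕ → Ω → Lp ℝ 2 ν)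
    (hX : ∀ n, ∀ i ∈ Finset.Icc 1 n, ∀ ω, X n i ω = m n i + ε i ω)
    (hH0 : ∀ n, ∀ i ∈ Finset.Icc 1 n, ∀ j ∈ Finset.Icc 1 n, m n i = m n j)
    -- the weight function
    (h : ℝ → ℝ) (hh : IsGradualWeight h)
    -- the consistent covariance estimator with its leading eigenvalues and eigenfunctions
    (d : ℕ) (Chat : ℕ → Ω → (Lp ℝ 2 ν →L[ℝ] Lp ℝ 2 ν))
    (hChat : TendstoInMeasure P Chat atTop (fun _ => longRunCovOp ε P))
    (lamhat : ℕ → Fin d → Ω → ℝ) (vhat : ℕ → Fin d → Ω → Lp ℝ 2 ν)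
    (hlamhat_meas : ∀ n p, Measurable (lamhat n p)) (hvhat_meas : ∀ n p, Measurable (vhat n p))
    (heig : ∀ n, ∀ᵐ ω ∂P,
      IsLeadingEigensystem (Chat n ω) (fun p => lamhat n p ω) (fun p => vhat n p ω))
    -- the first `d` eigenvalues are distinct and positive
    (hlam_strict : ∀ p q : Fin d, p < q → lam q < lam p)
    (hlam_pos : ∀ p : Fin d, 0 < lam p)
    -- consistency of the eigenfunctions, up to sign, and of the eigenvalues
    (hvhat : ∀ p : Fin d, TendstoInMeasure P
      (fun n ω => vhat n p ω - Real.sign ⟪vhat n p ω, v p⟫ • v p) atTop (fun _ => 0))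
    (hlamhat : ∀ p : Fin d, TendstoInMeasure P (fun n ω => lamhat n p ω - lam p) atTop
      (fun _ => 0))
    -- independent Brownian bridges
    {Ω'' : Type*} [MeasurableSpace Ω''] (P'' : Measure Ω'') [IsProbabilityMeasure P'']
    (B : Fin d → I → Ω'' → ℝ) (hB : ∀ p, IsBrownianBridge (B p) P'')
    (hB_indep : iIndepFun (fun p ω t => B p t ω) P'') :
    TendstoInDistribution
      (fun n ω => gradualPCStat h n (fun i => X n i ω) (fun p => lamhat n p ω)
        (fun p => vhat n p ω))
      atTop
      (fun ω => ⨆ t : I, √(∑ p : Fin d, gradualLimitPath hh (fun s => B p s ω) t ^ 2))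
      (fun _ => P) P'' := by
  have hsep : SecondCountableTopology (Lp ℝ 2 ν) := UniformSpace.secondCountable_of_separable _
  refine tendstoInDistribution_gradualPCStat P ε hε_meas (longRunCovOp ε P) (fun p => lam p)
    (fun p => v p) (hv.comp _ Fin.val_injective) hlam_pos (fun p => ?_) P' W hW hFCLT m X hX hH0 h hh
    lamhat vhat hlamhat_meas hvhat_meas
    (fun n => (heig n).mono fun ω hω p => hω.orthonormal.1 p) hvhat hlamhat P'' B hB hB_indep
  refine (hspec (v p)).unique ?_
  convert hasSum_single (p : ℕ) fun q hq => ?_ using 1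
  · simp [InnerProductSpace.rankOne_apply, hv.1 p]
  · simp [InnerProductSpace.rankOne_apply, hv.2 hq]
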